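/- **Theorem (joint communication–control outage under zero forcing).** *System.* A base station with $M\ge 2$ antennas serves a communication user (U) and a controllable device (D) with channels $\mathbf h_U\sim\mathcal{CN}(\mathbf 0,\beta_U\mathbf I_M)$ and $\mathbf h_D\sim\mathcal{CN}(\mathbf 0,\beta_D\mathbf I_M)$, which are independent. All of $\beta_U,\beta_D$, the powers $P_{\rm up},P_{\rm dn}$, the bandwidths $B_{\rm up},B_{\rm dn}$, the noise density $N_0$, the sampling period $T_s$, the payload $Q_U$ and the process noise variance $\sigma_w^2$ are positive; $\sigma_{\rm up}^2=N_0B_{\rm up}$, $\sigma_{\rm dn}^2=N_0B_{\rm dn}$, $\alpha_{\rm up}=B_{\rm up}T_s$, $\alpha_{\rm dn}=B_{\rm dn}T_s$. For beams $\mathbf w_D,\mathbf w_U\in\mathbb C^M$ let $$\mathrm{SNR}_D^{\rm up}=\frac{P_{\rm up}\|\mathbf h_D\|^2}{\sigma_{\rm up}^2},\quad \mathrm{SINR}_D=\frac{|\mathbf h_D^H\mathbf w_D|^2}{|\mathbf h_D^H\mathbf w_U|^2+\sigma_{\rm dn}^2},\quad \mathrm{SINR}_U=\frac{|\mathbf h_U^H\mathbf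 w_U|^2}{|\mathbf h_U^H\mathbf w_D|^2+\sigma_{\rm dn}^2}.$$ *Metrics.* The delay is $\tau_U=Q_U/\bigl(B_{\rm dn}\log_2(1+\mathrm{SINR}_U)\bigr)$, with $\tau_U=\infty$ if $\mathrm{SINR}_U=0$. The device is the plant $x_{n+1}=a x_n+b u_n+w_n$ with $a,b\in\mathbb C$, $|a|>1$, $b\ne0$, i.i.d. noise $w_n\sim\mathcal{CN}(0,\sigma_w^2)$ independent of everything else, and $x_0\sim\mathcal{CN}(0,V_0)$ for some $V_0\ge0$. Write $V_n=\mathbb E|x_n|^2$ for a fixed channel realization. The station obtains a reconstruction $\hat x_n$ of $x_n$ with distortion $D_n^{\rm up}=V_n(1+\mathrm{SNR}_D^{\rm up})^{-\alpha_{\rm up}}$, forms the command $d_n=-(a/b)\hat x_n$, and the device applies its reconstruction $u_n=\hat d_n$ of $d_n$, with distortion $D_n^{\rm dn}=\frac{|a|^2}{|b|^2}(V_n-D_n^{\rm up})(1+\mathrm{SINR}_D)^{-\alpha_{\rm dn}}$. Both reconstructions are Gaussian rate-distortion optimal: $x_n-\hat x_n\sim\mathcal{CN}(0,D_n^{\rm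 up})$ is independent of $\hat x_n$ and of $(d_n,\hat d_n)$, and $d_n-\hat d_n\sim\mathcal{CN}(0,D_n^{\rm dn})$ is independent of $\hat d_n$. The steady-state control variance is $V_\infty=\lim_n V_n\in[0,\infty]$, infinite if the loop is unstable. *Zero forcing.* With $\mathbf P_k^\perp=\mathbf I_M-\mathbf h_k\mathbf h_k^H/\|\mathbf h_k\|^2$ for $k\in\{U,D\}$ and a power split $p_D\in[0,P_{\rm dn}]$, $p_U=P_{\rm dn}-p_D$, $$\mathbf w_D=\sqrt{p_D}\,\frac{\mathbf P_U^\perp\mathbf h_D}{\|\mathbf P_U^\perp\mathbf h_D\|},\qquad \mathbf w_U=\sqrt{p_U}\,\frac{\mathbf P_D^\perp\mathbf h_U}{\|\mathbf P_D^\perp\mathbf h_U\|}.$$ For thresholds $\tau_{\rm req}>0$ and $V_{\rm req}>\sigma_w^2$ the joint outage probability is $$P_{\rm out}^{\rm ZF}=1-\Pr\bigl(\exists\,p_D\in[0,P_{\rm dn}]:\ \tau_U\le\tau_{\rm req}\ \text{and}\ V_\infty\le V_{\rm req}\bigr),$$ where the power split may depend on the channel realization. *Notation.* Let $\bar\gamma_{\rm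 up}=P_{\rm up}\beta_D/\sigma_{\rm up}^2$, $\bar\gamma_d=P_{\rm dn}\beta_D/\sigma_{\rm dn}^2$, $\gamma_U^{\rm req}=2^{Q_U/(B_{\rm dn}\tau_{\rm req})}-1$, $\eta_U=\gamma_U^{\rm req}\sigma_{\rm dn}^2/(P_{\rm dn}\beta_U)$, $$\eta_V=\frac1{\bar\gamma_{\rm up}}\Bigl[\Bigl(\frac{|a|^2V_{\rm req}}{V_{\rm req}-\sigma_w^2}\Bigr)^{1/\alpha_{\rm up}}-1\Bigr],\qquad S_\alpha(x)=(1+\bar\gamma_{\rm up}x)^{\alpha_{\rm up}},$$ and, for $x>\eta_V$, $$\gamma_D^{\rm req}(x)=\Bigl(\frac{|a|^2V_{\rm req}(S_\alpha(x)-1)}{S_\alpha(x)(V_{\rm req}-\sigma_w^2)-|a|^2V_{\rm req}}\Bigr)^{1/\alpha_{\rm dn}}-1,\quad \eta_f(x)=\frac{\gamma_D^{\rm req}(x)}{\bar\gamma_d},\quad \phi(x,r)=\frac{\eta_Ux}{(1-r)x-\eta_f(x)}.$$ Let $f_G(x)=\frac{x^{M-1}e^{-x}}{(M-1)!}$ and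 $F_G(x)=1-e^{-x}\sum_{k=0}^{M-1}\frac{x^k}{k!}$ (density and distribution function of $\mathrm{Gamma}(M,1)$ for $x\ge0$), $f_\rho(r)=(M-1)(1-r)^{M-2}$ (density of $\mathrm{Beta}(1,M-1)$ for $0\le r\le1$), and $[z]^+=\max(z,0)$. *Claim.* $$P_{\rm out}^{\rm ZF}=1-\int_{\eta_V}^{\infty}\int_0^{[1-\eta_f(x)/x]^+}f_G(x)\,f_\rho(r)\,\bigl[1-F_G(\phi(x,r))\bigr]\,\mathrm dr\,\mathrm dx ,$$ and the inner integral (for each $x>\eta_V$) and the outer integral converge absolutely. -/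

import Mathlib

open MeasureTheory ProbabilityTheory Filter Topology Set
open scoped ENNReal NNReal

noncomputable section

/-! ### Circularly symmetric complex Gaussian laws -/

/-- `CN(0, v)`: independent real and imaginary parts, each `N(0, v / 2)`, so that `E|z|² = v`. -/
def complexNormal (v : ℝ) : Measure ℂ :=
  ((gaussianReal 0 (v / 2).toNNReal).prod (gaussianReal 0 (v / 2).toNNReal)).map
    (fun p : ℝ × ℝ => (⟨p.1, p.2⟩ : ℂ))

/-- `CN(0, v I_M)`: independent `CN(0, v)` entries. -/
def complexNormalVec (M : ℕ) (v : ℝ) : Measure (EuclideanSpace ℂ (Fin M)) :=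
  (Measure.pi (fun _ : Fin M => complexNormal v)).map (fun z => WithLp.toLp 2 z)

/-! ### Rates and distortions -/

/-- Achievable rate (bit/s) over bandwidth `B` at the given SNR or SINR. -/
def achievableRate (B snr : ℝ) : ℝ := B * Real.logb 2 (1 + snr)

/-- The distortion `D` of a complex Gaussian source of variance `v` described with `R` bits per
sample, that is, the solution of `log₂ (v / D) = R`. -/
def gaussianDistortion (v R : ℝ) : ℝ := v * (2 : ℝ) ^ (-R)

/-! ### The system -/

/-- Parameters of a system with one `M`-antenna base station, one communication user (CU) and one
controllable device (CD). -/
structure JDCCSystem where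
  /-- number of antennas -/
  M : ℕ
  /-- plant coefficients in `x (n+1) = a x n + b u n + w n` -/
  a : ℂ
  b : ℂ
  /-- process noise variance -/
  noiseVar : ℝ
  /-- variance of the initial state -/
  initVar : ℝ
  /-- uplink transmit power and downlink power budget -/
  Pup : ℝ
  Pdn : ℝ
  /-- noise power spectral density -/
  N0 : ℝ
  /-- uplink and downlink bandwidths -/
  Bup : ℝ
  Bdn : ℝ
  /-- control sampling period -/
  Ts : ℝ
  /-- large-scale path-loss coefficients of the CD and of the CU -/
  betaD : ℝ
  betaU : ℝ
  /-- communication payload in bits -/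
  QU : ℝ
  two_le_M : 2 ≤ M
  one_lt_a : 1 < ‖a‖
  b_ne_zero : b ≠ 0
  noiseVar_pos : 0 < noiseVar
  initVar_nonneg : 0 ≤ initVar
  Pup_pos : 0 < Pup
  Pdn_pos : 0 < Pdn
  N0_pos : 0 < N0
  Bup_pos : 0 < Bup
  Bdn_pos : 0 < Bdn
  Ts_pos : 0 < Ts
  betaD_pos : 0 < betaD
  betaU_pos : 0 < betaU
  QU_pos : 0 < QU

namespace JDCCSystem

variable (S : JDCCSystem)

/-- Channel and beamforming vectors. -/
abbrev Vec : Type := EuclideanSpace ℂ (Fin S.M)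

/-- Receiver noise variance in the uplink. -/
def sigmaUp : ℝ := S.N0 * S.Bup

/-- Receiver noise variance in the downlink. -/
def sigmaDn : ℝ := S.N0 * S.Bdn

/-! #### Signal-to-noise ratios -/

/-- Uplink SNR of the CD after maximum-ratio combining. -/
def snrUp (hD : S.Vec) : ℝ := S.Pup * ‖hD‖ ^ 2 / S.sigmaUp

/-- Downlink SINR at a receiver with channel `h`, for the intended beam `w` and the interfering
beam `w'`; here `inner ℂ h w = hᴴ w`. -/
def sinrDn (h w w' : S.Vec) : ℝ :=
  ‖inner ℂ h w‖ ^ 2 / (‖inner ℂ h w'‖ ^ 2 + S.sigmaDn)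

/-! #### Communication delay -/

/-- Transmission delay of the payload, infinite when the rate is zero. -/
def delay (sinrU : ℝ) : ℝ≥0∞ :=
  ENNReal.ofReal S.QU / ENNReal.ofReal (achievableRate S.Bdn sinrU)

/-! #### Closed control loop -/

/-- Law of the next state when the present state has law `CN(0, V)` and the uplink and the downlink
carry `Rup` and `Rdn` bits in the control interval.

With `Dup`, `Ddn` the uplink and downlink distortions, the rate-distortion optimal reconstructions
have errors `Δx = x - x̂ ∼ CN(0, Dup)` and `Δd = d - d̂ ∼ CN(0, Ddn)`, where `Δd` is independent of
`d̂`, and `Δx` is independent of `x̂` (hence of the control link).  The command is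
`d = -(a / b) x̂`, the input is `u = d̂`, and the noise `w ∼ CN(0, noiseVar)` is independent of
everything else.  The independent variables are `d̂`, `Δd`, `Δx`, `w`, in this order. -/
def nextStateLaw (Rup Rdn V : ℝ) : Measure ℂ :=
  let Dup := gaussianDistortion V Rup
  let Vd := ‖S.a‖ ^ 2 / ‖S.b‖ ^ 2 * (V - Dup)
  let Ddn := gaussianDistortion Vd Rdn
  (((complexNormal (Vd - Ddn)).prod (complexNormal Ddn)).prod
    ((complexNormal Dup).prod (complexNormal S.noiseVar))).map
    (fun z : (ℂ × ℂ) × (ℂ × ℂ) =>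
      let dHat := z.1.1
      let d := dHat + z.1.2
      let xHat := -(S.b / S.a) * d
      let x := xHat + z.2.1
      S.a * x + S.b * dHat + z.2.2)

/-- Law of the state `x n`, started from `CN(0, initVar)`. -/
def stateLaw (Rup Rdn : ℝ) : ℕ → Measure ℂ
  | 0 => complexNormal S.initVar
  | n + 1 => S.nextStateLaw Rup Rdn (∫ x, ‖x‖ ^ 2 ∂(stateLaw Rup Rdn n))

/-- State variance `V n = E|x n|²` at uplink SNR `snr` and downlink SINR `sinrD`. -/
def stateVar (snr sinrD : ℝ) (n : ℕ) : ℝ :=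
  ∫ x, ‖x‖ ^ 2 ∂(S.stateLaw (achievableRate S.Bup snr * S.Ts) (achievableRate S.Bdn sinrD * S.Ts) n)

/-- Steady-state variance, the limit of `V n`; it is infinite when the loop is unstable. -/
def steadyVar (snr sinrD : ℝ) : ℝ≥0∞ :=
  limsup (fun n => ENNReal.ofReal (S.stateVar snr sinrD n)) atTop

/-! #### Zero forcing -/

/-- `(I - h hᴴ / ‖h‖²) v`. -/
def nullProj (h v : S.Vec) : S.Vec := v - (inner ℂ h v / (‖h‖ : ℂ) ^ 2) • h

/-- Zero-forcing beam of power `p` for the user with channel `h`, nulled at the channel `h'`. -/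
def zfBeam (p : ℝ) (h h' : S.Vec) : S.Vec :=
  ((Real.sqrt p / ‖S.nullProj h' h‖ : ℝ) : ℂ) • S.nullProj h' h

/-- Under zero forcing, some split of the downlink power meets both requirements. -/
def ZFSuccess (τreq Vreq : ℝ) (hD hU : S.Vec) : Prop :=
  ∃ pD ∈ Icc (0 : ℝ) S.Pdn,
    let wD := S.zfBeam pD hD hU
    let wU := S.zfBeam (S.Pdn - pD) hU hD
    S.delay (S.sinrDn hU wU wD) ≤ ENNReal.ofReal τreq ∧
      S.steadyVar (S.snrUp hD) (S.sinrDn hD wD wU) ≤ ENNReal.ofReal Vreq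

/-- Joint outage probability under zero forcing, for random channels `hD`, `hU`. -/
def zfOutage {Ω : Type*} [MeasurableSpace Ω] (P : Measure Ω) (hD hU : Ω → S.Vec)
    (τreq Vreq : ℝ) : ℝ :=
  1 - P.real {ω | S.ZFSuccess τreq Vreq (hD ω) (hU ω)}

/-! #### Quantities in the closed form -/

def alphaUp : ℝ := S.Bup * S.Ts

def alphaDn : ℝ := S.Bdn * S.Ts

def gammaBarUp : ℝ := S.Pup * S.betaD / S.sigmaUp

def gammaBarD : ℝ := S.Pdn * S.betaD / S.sigmaDn

/-- Required communication SINR. -/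
def gammaUReq (τreq : ℝ) : ℝ := (2 : ℝ) ^ (S.QU / (S.Bdn * τreq)) - 1

def etaU (τreq : ℝ) : ℝ := S.gammaUReq τreq * S.sigmaDn / (S.Pdn * S.betaU)

def etaV (Vreq : ℝ) : ℝ :=
  1 / S.gammaBarUp *
    ((‖S.a‖ ^ 2 * Vreq / (Vreq - S.noiseVar)) ^ (1 / S.alphaUp) - 1)

/-- `S_α` as a function of the normalized channel gain. -/
def uplinkQuality (x : ℝ) : ℝ := (1 + S.gammaBarUp * x) ^ S.alphaUp

/-- Required control SINR as a function of the normalized channel gain. -/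
def gammaDReq (Vreq x : ℝ) : ℝ :=
  (‖S.a‖ ^ 2 * Vreq * (S.uplinkQuality x - 1) /
    (S.uplinkQuality x * (Vreq - S.noiseVar) - ‖S.a‖ ^ 2 * Vreq)) ^ (1 / S.alphaDn) - 1

def etaF (Vreq x : ℝ) : ℝ := S.gammaDReq Vreq x / S.gammaBarD

def phi (τreq Vreq x r : ℝ) : ℝ := S.etaU τreq * x / ((1 - r) * x - S.etaF Vreq x)

/-- Density of `Gamma(M, 1)` on the positive half-line. -/
def gainPDF (x : ℝ) : ℝ := x ^ (S.M - 1) * Real.exp (-x) / (Nat.factorial (S.M - 1) : ℝ)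

/-- Distribution function of `Gamma(M, 1)` on the positive half-line. -/
def gainCDF (x : ℝ) : ℝ :=
  1 - Real.exp (-x) * ∑ k ∈ Finset.range S.M, x ^ k / (Nat.factorial k : ℝ)

/-- Density of `Beta(1, M - 1)` on the unit interval. -/
def corrPDF (r : ℝ) : ℝ := ((S.M : ℝ) - 1) * (1 - r) ^ (S.M - 2)

/-- The integrand of the closed form. -/
def zfIntegrand (τreq Vreq x r : ℝ) : ℝ :=
  S.gainPDF x * S.corrPDF r * (1 - S.gainCDF (S.phi τreq Vreq x r))

/-- The upper end of the inner integral, `[1 - η_f(x) / x]⁺`. -/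
def zfUpper (Vreq x : ℝ) : ℝ := max (1 - S.etaF Vreq x / x) 0

end JDCCSystem

end

/-!
Four facts carry the proof.

*Control.*  Independent circular Gaussians add up to a circular Gaussian (characteristic functions),
so the closed loop sends the law `CN(0, V)` to `CN(0, c V + σ²)`, where `c = loopGain` depends on
the two SNRs (`JDCCSystem.nextStateLaw_eq`): the input `b d̂` cancels its own contribution to `a x̂`,
and only the two reconstruction errors and the noise remain.  Hence `V∞ = σ² / (1 - c)` if `c < 1`
and `V∞ = ∞` otherwise, and `V∞ ≤ Vreq` means `x > η_V` and `SINR_D ≥ γ_D^req(x)`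
(`JDCCSystem.loopGain_mul_le_iff`), with `x` the normalized gain of the control channel.

*Geometry.*  Zero forcing removes the interference and leaves both users the fraction `1 - r` of
their gain, where `r` is the squared correlation of the two channels.  A feasible power split exists
iff the powers that the two users need add up to at most `Pdn`, which is the condition
`(1 - r) x > η_f(x)` and `y ≥ φ(x, r)` (`JDCCSystem.zfSuccess_iff`), with `y` the normalized gain of
the communication channel.

*Law of `(x, r, y)`.*  Given `hU`, unitary invariance turns the direction of `hU` into the first
coordinate axis, so that `x = e + s` and `r = e / (e + s)` with independent `e ∼ Exp(1)` and
`s ∼ Gamma(M - 1, 1)`.  The substitution `(e, s) = (x r, x (1 - r))` shows that `x ∼ Gamma(M, 1)`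
and `r ∼ Beta(1, M - 1)` are independent, whatever `hU` is (`lintegral_gain_correlation`).

*Integration.*  Integrating out `y` gives the factor `1 - F_G(φ(x, r))`.  All integrals are computed
as Lebesgue integrals of nonnegative functions (`JDCCSystem.measure_zfSuccess`); their value is a
probability, hence finite, which yields absolute convergence.
-/

/-! ### Circular Gaussian laws -/

lemma measurable_complex_mk : Measurable (fun p : ℝ × ℝ => (⟨p.1, p.2⟩ : ℂ)) :=
  Complex.measurableEquivRealProd.symm.measurable

instance isProbabilityMeasure_complexNormal (v : ℝ) : IsProbabilityMeasure (complexNormal v) :=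
  Measure.isProbabilityMeasure_map measurable_complex_mk.aemeasurable

lemma charFun_complexNormal {v : ℝ} (hv : 0 ≤ v) (t : ℂ) :
    charFun (complexNormal v) t = Complex.exp (-(v * ‖t‖ ^ 2 / 4 : ℝ)) := by
  have hv2 : ((v / 2).toNNReal : ℝ) = v / 2 := Real.coe_toNNReal _ (by positivity)
  rw [charFun_apply, complexNormal,
    integral_map measurable_complex_mk.aemeasurable (by fun_prop)]
  have h : ∀ p : ℝ × ℝ, Complex.exp (((inner ℝ (⟨p.1, p.2⟩ : ℂ) t : ℝ) : ℂ) * Complex.I) =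
      Complex.exp (t.re * p.1 * Complex.I) * Complex.exp (t.im * p.2 * Complex.I) := by
    intro p
    rw [← Complex.exp_add, Complex.inner]
    congr 1
    simp
    ring
  simp_rw [h]
  rw [integral_prod_mul (fun x : ℝ => Complex.exp (t.re * x * Complex.I))
    (fun x : ℝ => Complex.exp (t.im * x * Complex.I)), ← charFun_apply_real,
    ← charFun_apply_real, charFun_gaussianReal, charFun_gaussianReal, ← Complex.exp_add, hv2,
    ← Complex.normSq_eq_norm_sq, Complex.normSq_apply]
  congr 1
  push_cast
  ring

lemma charFun_complexNormal_mul {v : ℝ} (hv : 0 ≤ v) (c t : ℂ) :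
    ∫ z, Complex.exp (((inner ℝ (c * z) t : ℝ) : ℂ) * Complex.I) ∂(complexNormal v) =
      Complex.exp (-(‖c‖ ^ 2 * v * ‖t‖ ^ 2 / 4 : ℝ)) := by
  have h : ∀ z : ℂ, inner ℝ (c * z) t = inner ℝ z ((starRingEnd ℂ) c * t) := by
    intro z
    simp [Complex.inner]
    ring
  simp_rw [h]
  rw [← charFun_apply, charFun_complexNormal hv, norm_mul, RCLike.norm_conj]
  congr 4
  ring

lemma integral_norm_sq_complexNormal {v : ℝ} (hv : 0 ≤ v) :
    ∫ z, ‖z‖ ^ 2 ∂(complexNormal v) = v := by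
  have hint : Integrable (fun x : ℝ => x ^ 2) (gaussianReal 0 (v / 2).toNNReal) :=
    (memLp_id_gaussianReal (μ := 0) (v := (v / 2).toNNReal) 2).integrable_sq
  have hvar : ∫ x : ℝ, x ^ 2 ∂(gaussianReal 0 (v / 2).toNNReal) = v / 2 := by
    have h := variance_fun_id_gaussianReal (μ := 0) (v := (v / 2).toNNReal)
    rw [variance_of_integral_eq_zero aemeasurable_id' (by simp)] at h
    rw [h, Real.coe_toNNReal _ (by positivity)]
  rw [complexNormal, integral_map measurable_complex_mk.aemeasurable (by fun_prop)]
  have h : ∀ p : ℝ × ℝ, ‖(⟨p.1, p.2⟩ : ℂ)‖ ^ 2 = p.1 ^ 2 + p.2 ^ 2 := by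
    intro p
    rw [← Complex.normSq_eq_norm_sq, Complex.normSq_apply]
    ring
  simp_rw [h]
  rw [integral_add (hint.comp_fst _) (hint.comp_snd _)]
  rw [integral_fun_fst (fun x : ℝ => x ^ 2), integral_fun_snd (fun x : ℝ => x ^ 2), hvar]
  simp

namespace JDCCSystem

variable (S : JDCCSystem)

/-! ### The closed control loop -/

/-- The closed loop maps `CN(0, V)` to a centred circular Gaussian law whose variance is affine
in `V`. -/
lemma nextStateLaw_eq {Rup Rdn V : ℝ} (hR : 0 ≤ Rup) (hV : 0 ≤ V) :
    S.nextStateLaw Rup Rdn V = complexNormal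
      (‖S.a‖ ^ 2 * ((2 : ℝ) ^ (-Rup) + (1 - (2 : ℝ) ^ (-Rup)) * (2 : ℝ) ^ (-Rdn)) * V
        + S.noiseVar) := by
  have hs0 : (0 : ℝ) < (2 : ℝ) ^ (-Rup) := by positivity
  have ht0 : (0 : ℝ) < (2 : ℝ) ^ (-Rdn) := by positivity
  have hs1 : (2 : ℝ) ^ (-Rup) ≤ 1 :=
    Real.rpow_le_one_of_one_le_of_nonpos (by norm_num) (by linarith)
  have ha : S.a ≠ 0 := by
    have := S.one_lt_a
    intro h
    rw [h, norm_zero] at this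
    linarith
  have hb := S.b_ne_zero
  have hN := S.noiseVar_pos
  rw [nextStateLaw]
  set Dup := gaussianDistortion V Rup with hDup
  set Vd := ‖S.a‖ ^ 2 / ‖S.b‖ ^ 2 * (V - Dup) with hVd
  set Ddn := gaussianDistortion Vd Rdn with hDdn
  have hDup0 : 0 ≤ Dup := mul_nonneg hV hs0.le
  have hVd0 : 0 ≤ Vd := by
    refine mul_nonneg (by positivity) ?_
    rw [hDup, gaussianDistortion]
    nlinarith
  have hDdn0 : 0 ≤ Ddn := mul_nonneg hVd0 ht0.le
  -- The input `b d̂` cancels its own contribution to `a x̂`; the errors and the noise remain.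
  have hfun : (fun z : (ℂ × ℂ) × (ℂ × ℂ) =>
      S.a * (-(S.b / S.a) * (z.1.1 + z.1.2) + z.2.1) + S.b * z.1.1 + z.2.2) =
      fun z => (-S.b) * z.1.2 + (S.a * z.2.1 + 1 * z.2.2) := by
    funext z
    field_simp
    ring
  have hmeas : Measurable (fun z : (ℂ × ℂ) × (ℂ × ℂ) =>
      (-S.b) * z.1.2 + (S.a * z.2.1 + 1 * z.2.2)) := by fun_prop
  simp only [hfun]
  have : IsProbabilityMeasure ((((complexNormal (Vd - Ddn)).prod (complexNormal Ddn)).prod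
    ((complexNormal Dup).prod (complexNormal S.noiseVar))).map
      (fun z : (ℂ × ℂ) × (ℂ × ℂ) => (-S.b) * z.1.2 + (S.a * z.2.1 + 1 * z.2.2))) :=
    Measure.isProbabilityMeasure_map hmeas.aemeasurable
  refine Measure.ext_of_charFun (funext fun t => ?_)
  rw [charFun_apply, integral_map hmeas.aemeasurable (by fun_prop), charFun_complexNormal]
  · have h : ∀ z : (ℂ × ℂ) × (ℂ × ℂ),
        Complex.exp (((inner ℝ ((-S.b) * z.1.2 + (S.a * z.2.1 + 1 * z.2.2)) t : ℝ) : ℂ)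
          * Complex.I) =
        Complex.exp (((inner ℝ ((-S.b) * z.1.2) t : ℝ) : ℂ) * Complex.I) *
        (Complex.exp (((inner ℝ (S.a * z.2.1) t : ℝ) : ℂ) * Complex.I) *
        Complex.exp (((inner ℝ (1 * z.2.2) t : ℝ) : ℂ) * Complex.I)) := by
      intro z
      rw [← Complex.exp_add, ← Complex.exp_add, inner_add_left, inner_add_left]
      congr 1
      push_cast
      ring
    simp_rw [h]
    rw [integral_prod_mul
      (fun z : ℂ × ℂ => Complex.exp (((inner ℝ ((-S.b) * z.2) t : ℝ) : ℂ) * Complex.I))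
      (fun z : ℂ × ℂ => Complex.exp (((inner ℝ (S.a * z.1) t : ℝ) : ℂ) * Complex.I) *
        Complex.exp (((inner ℝ (1 * z.2) t : ℝ) : ℂ) * Complex.I)),
      integral_prod_mul
      (fun z : ℂ => Complex.exp (((inner ℝ (S.a * z) t : ℝ) : ℂ) * Complex.I))
      (fun z : ℂ => Complex.exp (((inner ℝ (1 * z) t : ℝ) : ℂ) * Complex.I)),
      integral_fun_snd
      (fun z : ℂ => Complex.exp (((inner ℝ ((-S.b) * z) t : ℝ) : ℂ) * Complex.I)),
      charFun_complexNormal_mul hDdn0, charFun_complexNormal_mul hDup0,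
      charFun_complexNormal_mul hN.le]
    simp only [probReal_univ, one_smul]
    rw [← Complex.exp_add, ← Complex.exp_add, norm_neg, norm_one]
    congr 1
    have hb' : ‖S.b‖ ≠ 0 := norm_ne_zero_iff.mpr hb
    have hexp : ‖S.b‖ ^ 2 * Ddn =
        ‖S.a‖ ^ 2 * ((1 - (2 : ℝ) ^ (-Rup)) * (2 : ℝ) ^ (-Rdn)) * V := by
      rw [hDdn, gaussianDistortion, hVd, hDup, gaussianDistortion]
      field_simp
    have hexp' : Dup = V * (2 : ℝ) ^ (-Rup) := rfl
    rw [hexp, hexp']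
    norm_cast
    ring
  · have : 0 ≤ (1 - (2 : ℝ) ^ (-Rup)) * (2 : ℝ) ^ (-Rdn) := mul_nonneg (by linarith) ht0.le
    positivity

/-- The factor by which one control interval multiplies the state variance, at uplink SNR `snr`
and downlink SINR `sinrD`. -/
noncomputable def loopGain (snr sinrD : ℝ) : ℝ :=
  ‖S.a‖ ^ 2 * ((1 + snr) ^ (-S.alphaUp) + (1 - (1 + snr) ^ (-S.alphaUp))
    * (1 + sinrD) ^ (-S.alphaDn))

lemma two_rpow_neg_achievableRate {B snr : ℝ} (hs : 0 ≤ snr) :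
    (2 : ℝ) ^ (-(achievableRate B snr * S.Ts)) = (1 + snr) ^ (-(B * S.Ts)) := by
  have h : -(achievableRate B snr * S.Ts) = Real.logb 2 (1 + snr) * -(B * S.Ts) := by
    rw [achievableRate]
    ring
  rw [h, Real.rpow_mul (by norm_num), Real.rpow_logb (by norm_num) (by norm_num) (by linarith)]

lemma alphaUp_pos : 0 < S.alphaUp := mul_pos S.Bup_pos S.Ts_pos

lemma alphaDn_pos : 0 < S.alphaDn := mul_pos S.Bdn_pos S.Ts_pos

lemma rpow_neg_alphaUp_le_one {snr : ℝ} (hs : 0 ≤ snr) : (1 + snr) ^ (-S.alphaUp) ≤ 1 :=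
  Real.rpow_le_one_of_one_le_of_nonpos (by linarith) (by linarith [S.alphaUp_pos])

lemma loopGain_pos {snr sinrD : ℝ} (hs : 0 ≤ snr) (hd : 0 ≤ sinrD) :
    0 < S.loopGain snr sinrD := by
  have h1 := S.one_lt_a
  have h2 : 0 ≤ (1 - (1 + snr) ^ (-S.alphaUp)) * (1 + sinrD) ^ (-S.alphaDn) :=
    mul_nonneg (by linarith [S.rpow_neg_alphaUp_le_one hs]) (by positivity)
  have h3 : 0 < (1 + snr) ^ (-S.alphaUp) := by positivity
  exact mul_pos (by positivity) (by linarith)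

lemma stateVar_nonneg (snr sinrD : ℝ) (n : ℕ) : 0 ≤ S.stateVar snr sinrD n :=
  integral_nonneg fun _ => by positivity

lemma stateVar_zero (snr sinrD : ℝ) : S.stateVar snr sinrD 0 = S.initVar :=
  integral_norm_sq_complexNormal S.initVar_nonneg

lemma stateVar_succ {snr sinrD : ℝ} (hs : 0 ≤ snr) (hd : 0 ≤ sinrD) (n : ℕ) :
    S.stateVar snr sinrD (n + 1) =
      S.loopGain snr sinrD * S.stateVar snr sinrD n + S.noiseVar := by
  have hR : 0 ≤ achievableRate S.Bup snr * S.Ts :=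
    mul_nonneg (mul_nonneg S.Bup_pos.le (Real.logb_nonneg (by norm_num) (by linarith)))
      S.Ts_pos.le
  have hlaw : S.stateLaw (achievableRate S.Bup snr * S.Ts) (achievableRate S.Bdn sinrD * S.Ts)
      (n + 1) = complexNormal
        (S.loopGain snr sinrD * S.stateVar snr sinrD n + S.noiseVar) := by
    change S.nextStateLaw _ _ (S.stateVar snr sinrD n) = _
    rw [nextStateLaw_eq S hR (S.stateVar_nonneg snr sinrD n),
      two_rpow_neg_achievableRate S hs, two_rpow_neg_achievableRate S hd]
    rfl
  rw [stateVar, hlaw, integral_norm_sq_complexNormal]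
  have := mul_nonneg (S.loopGain_pos hs hd).le (S.stateVar_nonneg snr sinrD n)
  linarith [S.noiseVar_pos]

lemma stateVar_eq {snr sinrD : ℝ} (hs : 0 ≤ snr) (hd : 0 ≤ sinrD) (n : ℕ) :
    S.stateVar snr sinrD n = S.loopGain snr sinrD ^ n * S.initVar +
      S.noiseVar * ∑ k ∈ Finset.range n, S.loopGain snr sinrD ^ k := by
  induction n with
  | zero => simp [stateVar_zero]
  | succ n ih =>
    rw [stateVar_succ S hs hd, ih, Finset.sum_range_succ', mul_add, mul_add, ← mul_assoc]
    simp only [pow_succ, ← Finset.sum_mul]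
    ring

lemma steadyVar_of_lt_one {snr sinrD : ℝ} (hs : 0 ≤ snr) (hd : 0 ≤ sinrD)
    (h : S.loopGain snr sinrD < 1) :
    S.steadyVar snr sinrD = ENNReal.ofReal (S.noiseVar / (1 - S.loopGain snr sinrD)) := by
  have h0 := (S.loopGain_pos hs hd).le
  refine Tendsto.limsup_eq (ENNReal.tendsto_ofReal ?_)
  rw [show S.stateVar snr sinrD = fun n => _ from funext (S.stateVar_eq hs hd)]
  have h1 := (tendsto_pow_atTop_nhds_zero_of_lt_one h0 h).mul_const S.initVar
  have h2 := (hasSum_geometric_of_lt_one h0 h).tendsto_sum_nat.const_mul S.noiseVar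
  simpa [div_eq_mul_inv] using h1.add h2

lemma steadyVar_of_one_le {snr sinrD : ℝ} (hs : 0 ≤ snr) (hd : 0 ≤ sinrD)
    (h : 1 ≤ S.loopGain snr sinrD) : S.steadyVar snr sinrD = ⊤ := by
  refine Tendsto.limsup_eq (ENNReal.tendsto_ofReal_atTop.comp ?_)
  refine tendsto_atTop_mono (f := fun n : ℕ => S.noiseVar * n) (fun n => ?_)
    (tendsto_natCast_atTop_atTop.const_mul_atTop S.noiseVar_pos)
  rw [stateVar_eq S hs hd]
  have h1 : (n : ℝ) ≤ ∑ k ∈ Finset.range n, S.loopGain snr sinrD ^ k := by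
    calc (n : ℝ) = ∑ k ∈ Finset.range n, (1 : ℝ) := by simp
      _ ≤ _ := Finset.sum_le_sum fun k _ => one_le_pow₀ h
  have h2 : 0 ≤ S.loopGain snr sinrD ^ n * S.initVar :=
    mul_nonneg (pow_nonneg (by linarith) _) S.initVar_nonneg
  nlinarith [S.noiseVar_pos]

lemma steadyVar_le_iff {snr sinrD Vreq : ℝ} (hs : 0 ≤ snr) (hd : 0 ≤ sinrD)
    (hV : S.noiseVar < Vreq) :
    S.steadyVar snr sinrD ≤ ENNReal.ofReal Vreq ↔
      S.loopGain snr sinrD * Vreq ≤ Vreq - S.noiseVar := by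
  have hN := S.noiseVar_pos
  rcases lt_or_ge (S.loopGain snr sinrD) 1 with h | h
  · rw [steadyVar_of_lt_one S hs hd h, ENNReal.ofReal_le_ofReal_iff (by linarith),
      div_le_iff₀ (by linarith)]
    constructor <;> intro <;> linarith
  · rw [steadyVar_of_one_le S hs hd h]
    simp only [top_le_iff, ENNReal.ofReal_ne_top, false_iff, not_le]
    nlinarith

lemma snrUp_nonneg (hD : S.Vec) : 0 ≤ S.snrUp hD := by
  have := S.Pup_pos
  have := mul_pos S.N0_pos S.Bup_pos
  rw [snrUp, sigmaUp]
  positivity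

lemma sigmaDn_pos : 0 < S.sigmaDn := mul_pos S.N0_pos S.Bdn_pos

lemma sinrDn_nonneg (h w w' : S.Vec) : 0 ≤ S.sinrDn h w w' := by
  have := S.sigmaDn_pos
  rw [sinrDn]
  positivity

lemma gammaUReq_pos {τreq : ℝ} (hτ : 0 < τreq) : 0 < S.gammaUReq τreq := by
  have := S.QU_pos
  have := S.Bdn_pos
  have : (1 : ℝ) < (2 : ℝ) ^ (S.QU / (S.Bdn * τreq)) :=
    Real.one_lt_rpow (by norm_num) (by positivity)
  rw [gammaUReq]
  linarith

lemma delay_le_iff {sinrU τreq : ℝ} (hs : 0 ≤ sinrU) (hτ : 0 < τreq) :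
    S.delay sinrU ≤ ENNReal.ofReal τreq ↔ S.gammaUReq τreq ≤ sinrU := by
  have hQ := S.QU_pos
  have hB := S.Bdn_pos
  rcases hs.eq_or_lt with rfl | hs
  · have h0 : S.delay 0 = ⊤ := by
      rw [delay, achievableRate]
      simp [ENNReal.div_zero, hQ]
    rw [h0]
    simp [S.gammaUReq_pos hτ]
  · have hlog : 0 < Real.logb 2 (1 + sinrU) := Real.logb_pos (by norm_num) (by linarith)
    have hrate : 0 < achievableRate S.Bdn sinrU := mul_pos hB hlog
    rw [delay, ← ENNReal.ofReal_div_of_pos hrate, ENNReal.ofReal_le_ofReal_iff hτ.le,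
      div_le_iff₀ hrate, gammaUReq, sub_le_iff_le_add', ← Real.le_logb_iff_rpow_le (by norm_num)
      (by linarith), div_le_iff₀ (by positivity), achievableRate]
    constructor <;> intro <;> linarith

end JDCCSystem

/-! ### The gain of a Gaussian vector -/

/-- In polar coordinates, `‖z‖² / v` is exponentially distributed under `CN(0, v)`. -/
lemma lintegral_norm_sq_complexNormal {v : ℝ} (hv : 0 < v) {f : ℝ → ℝ≥0∞} (hf : Measurable f) :
    ∫⁻ z, f (‖z‖ ^ 2 / v) ∂(complexNormal v) =
      ∫⁻ x in Ioi (0 : ℝ), ENNReal.ofReal (Real.exp (-x)) * f x := by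
  have hv2 : ((v / 2).toNNReal : ℝ) = v / 2 := Real.coe_toNNReal _ (by positivity)
  have hv0 : (v / 2).toNNReal ≠ 0 := by
    intro h
    rw [h] at hv2
    simp at hv2
    linarith
  have hpi := Real.pi_pos
  have hpdf : ∀ x y : ℝ, gaussianPDF 0 (v / 2).toNNReal x * gaussianPDF 0 (v / 2).toNNReal y =
      ENNReal.ofReal (Real.exp (-((x ^ 2 + y ^ 2) / v)) / (Real.pi * v)) := by
    intro x y
    rw [gaussianPDF, gaussianPDF, ← ENNReal.ofReal_mul (gaussianPDFReal_nonneg _ _ _),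
      gaussianPDFReal, gaussianPDFReal, hv2]
    congr 1
    have h1 : √(2 * Real.pi * (v / 2)) * √(2 * Real.pi * (v / 2)) = Real.pi * v := by
      rw [Real.mul_self_sqrt (by positivity)]
      ring
    have h2 : -((x ^ 2 + y ^ 2) / v) =
        -(x - 0) ^ 2 / (2 * (v / 2)) + -(y - 0) ^ 2 / (2 * (v / 2)) := by
      field_simp
      ring
    rw [h2, Real.exp_add, ← h1]
    field_simp
  have hg : Measurable fun p : ℝ × ℝ => gaussianPDF 0 (v / 2).toNNReal p.1 *
      gaussianPDF 0 (v / 2).toNNReal p.2 :=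
    ((measurable_gaussianPDF _ _).comp measurable_fst).mul
      ((measurable_gaussianPDF _ _).comp measurable_snd)
  have hF : Measurable fun r : ℝ => ENNReal.ofReal (2 * r / v) *
      (ENNReal.ofReal (Real.exp (-(r ^ 2 / v))) * f (r ^ 2 / v)) := by fun_prop
  have hnorm : ∀ p : ℝ × ℝ, ‖(⟨p.1, p.2⟩ : ℂ)‖ ^ 2 = p.1 ^ 2 + p.2 ^ 2 := by
    intro p
    rw [← Complex.normSq_eq_norm_sq, Complex.normSq_apply]
    ring
  have himg : (fun r : ℝ => r ^ 2 / v) '' Ioi 0 = Ioi 0 := by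
    ext x
    simp only [mem_image, mem_Ioi]
    constructor
    · rintro ⟨r, hr, rfl⟩
      positivity
    · intro hx
      refine ⟨√(x * v), by positivity, ?_⟩
      rw [Real.sq_sqrt (by positivity)]
      field_simp
  have hinj : InjOn (fun r : ℝ => r ^ 2 / v) (Ioi 0) := by
    intro r hr s hs h
    simp only [mem_Ioi] at hr hs
    have h' : r ^ 2 = s ^ 2 := by
      field_simp at h
      exact h
    exact (pow_left_inj₀ hr.le hs.le two_ne_zero).mp h'
  calc ∫⁻ z, f (‖z‖ ^ 2 / v) ∂(complexNormal v)
      = ∫⁻ p : ℝ × ℝ, ENNReal.ofReal (Real.exp (-((p.1 ^ 2 + p.2 ^ 2) / v)) / (Real.pi * v)) *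
          f ((p.1 ^ 2 + p.2 ^ 2) / v) := by
        rw [complexNormal, lintegral_map (by fun_prop) measurable_complex_mk,
          gaussianReal_of_var_ne_zero _ hv0,
          prod_withDensity (measurable_gaussianPDF _ _) (measurable_gaussianPDF _ _),
          lintegral_withDensity_eq_lintegral_mul _ hg (by
            simp_rw [hnorm]
            fun_prop)]
        simp_rw [Pi.mul_apply, hpdf, hnorm]
        rfl
    _ = ∫⁻ p in Ioi (0 : ℝ) ×ˢ Ioo (-Real.pi) Real.pi, ENNReal.ofReal p.1 *
          (ENNReal.ofReal (Real.exp (-(p.1 ^ 2 / v)) / (Real.pi * v)) * f (p.1 ^ 2 / v)) := by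
        rw [← lintegral_comp_polarCoord_symm]
        have h : ∀ p : ℝ × ℝ, (polarCoord.symm p).1 ^ 2 + (polarCoord.symm p).2 ^ 2 = p.1 ^ 2 := by
          intro p
          simp only [polarCoord_symm_apply]
          nlinarith [Real.sin_sq_add_cos_sq p.2]
        simp_rw [h]
        rfl
    _ = ∫⁻ r in Ioi (0 : ℝ), ENNReal.ofReal (2 * r / v) *
          (ENNReal.ofReal (Real.exp (-(r ^ 2 / v))) * f (r ^ 2 / v)) := by
        rw [Measure.volume_eq_prod, ← Measure.prod_restrict, lintegral_prod _ (by fun_prop)]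
        refine setLIntegral_congr_fun measurableSet_Ioi fun r hr => ?_
        simp only [lintegral_const, Measure.restrict_apply_univ, Real.volume_Ioo]
        have hr' : (0 : ℝ) < r := hr
        rw [mul_comm, ← mul_assoc, ← mul_assoc, ← mul_assoc, ← ENNReal.ofReal_mul (by linarith),
          ← ENNReal.ofReal_mul (by nlinarith), ← ENNReal.ofReal_mul (by positivity)]
        congr 2
        field_simp
        ring
    _ = ∫⁻ x in Ioi (0 : ℝ), ENNReal.ofReal (Real.exp (-x)) * f x := by
        conv_rhs => rw [← himg]
        rw [lintegral_image_eq_lintegral_abs_deriv_mul measurableSet_Ioi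
          (f' := fun r => 2 * r / v) (fun r _ => ?_) hinj]
        · refine setLIntegral_congr_fun measurableSet_Ioi fun r hr => ?_
          have hr' : (0 : ℝ) < r := hr
          rw [abs_of_pos (by positivity)]
        · have h := ((hasDerivAt_pow 2 r).div_const v).hasDerivWithinAt (s := Ioi 0)
          simpa using h

/-- The substitution `(e, s) = (x r, x (1 - r))` of the open quadrant, whose Jacobian is `x`. -/
lemma lintegral_quadrant_eq_lintegral_sum_ratio {H : ℝ → ℝ → ℝ≥0∞}
    (hH : Measurable (Function.uncurry H)) :
    ∫⁻ e in Ioi (0 : ℝ), ∫⁻ s in Ioi (0 : ℝ), H e s =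
      ∫⁻ x in Ioi (0 : ℝ), ∫⁻ r in Ioo (0 : ℝ) 1, ENNReal.ofReal x * H (x * r) (x * (1 - r)) := by
  have hmeas : Measurable (Function.uncurry fun e x : ℝ =>
      (Ioi (0 : ℝ)).indicator (fun e => (Ioi e).indicator (fun x => H e (x - e)) x) e) := by
    have hset : MeasurableSet {p : ℝ × ℝ | 0 < p.1 ∧ p.1 < p.2} :=
      (measurableSet_lt measurable_const measurable_fst).inter
        (measurableSet_lt measurable_fst measurable_snd)
    have hH' : Measurable fun p : ℝ × ℝ => H p.1 (p.2 - p.1) :=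
      hH.comp (measurable_fst.prodMk (measurable_snd.sub measurable_fst))
    convert hH'.indicator hset using 1
    funext p
    by_cases h1 : 0 < p.1 <;> by_cases h2 : p.1 < p.2 <;>
      simp [Function.uncurry, indicator, h1, h2]
  calc ∫⁻ e in Ioi (0 : ℝ), ∫⁻ s in Ioi (0 : ℝ), H e s
      = ∫⁻ e, ∫⁻ x, (Ioi (0 : ℝ)).indicator
          (fun e => (Ioi e).indicator (fun x => H e (x - e)) x) e := by
        rw [← lintegral_indicator measurableSet_Ioi]
        refine lintegral_congr fun e => ?_
        by_cases he : e ∈ Ioi (0 : ℝ)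
        · simp only [indicator_of_mem he]
          rw [← lintegral_indicator measurableSet_Ioi,
            ← lintegral_sub_right_eq_self (fun s => (Ioi (0 : ℝ)).indicator (fun s => H e s) s) e]
          refine lintegral_congr fun x => ?_
          by_cases hx : e < x <;> simp [indicator, hx]
        · simp [indicator_of_notMem he]
    _ = ∫⁻ x, ∫⁻ e, (Ioi (0 : ℝ)).indicator
          (fun e => (Ioi e).indicator (fun x => H e (x - e)) x) e :=
        lintegral_lintegral_swap hmeas.aemeasurable
    _ = ∫⁻ x in Ioi (0 : ℝ), ∫⁻ e in Ioo (0 : ℝ) x, H e (x - e) := by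
        rw [← lintegral_indicator measurableSet_Ioi]
        refine lintegral_congr fun x => ?_
        by_cases hx : x ∈ Ioi (0 : ℝ)
        · rw [indicator_of_mem hx, ← lintegral_indicator measurableSet_Ioo]
          refine lintegral_congr fun e => ?_
          by_cases h1 : 0 < e <;> by_cases h2 : e < x <;> simp [indicator, h1, h2]
        · rw [indicator_of_notMem hx, lintegral_eq_zero_of_ae_eq_zero]
          refine Eventually.of_forall fun e => ?_
          simp only [mem_Ioi, not_lt] at hx
          by_cases h1 : 0 < e
          · have h2 : ¬ e < x := by linarith
            simp [indicator, h2]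
          · simp [indicator, h1]
    _ = _ := by
        refine setLIntegral_congr_fun measurableSet_Ioi fun x hx => ?_
        have hx' : (0 : ℝ) < x := hx
        have himg : (fun r : ℝ => x * r) '' Ioo 0 1 = Ioo 0 x := by
          rw [image_mul_left_Ioo hx']
          simp
        rw [← himg, lintegral_image_eq_lintegral_abs_deriv_mul measurableSet_Ioo
          (f' := fun _ => x) (fun r _ => ?_) (mul_right_injective₀ hx'.ne').injOn]
        · simp only [abs_of_pos hx', mul_sub, mul_one]
        · simpa using ((hasDerivAt_id r).const_mul x).hasDerivWithinAt (s := Ioo 0 1)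

/-- If `E ∼ Exp(1)` and `G ∼ Gamma(n + 1, 1)` are independent, then `E + G` and `E / (E + G)` are
independent, with laws `Gamma(n + 2, 1)` and `Beta(1, n + 1)`. -/
lemma lintegral_exp_gamma_eq_lintegral_gamma_beta (n : ℕ) {g : ℝ → ℝ → ℝ≥0∞}
    (hg : Measurable (Function.uncurry g)) :
    ∫⁻ e in Ioi (0 : ℝ), ∫⁻ s in Ioi (0 : ℝ), ENNReal.ofReal (Real.exp (-e)) *
        (ENNReal.ofReal (s ^ n * Real.exp (-s) / n.factorial) * g (e + s) (e / (e + s))) =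
      ∫⁻ x in Ioi (0 : ℝ), ∫⁻ r in Ioo (0 : ℝ) 1,
        ENNReal.ofReal (x ^ (n + 1) * Real.exp (-x) / (n + 1).factorial) *
          (ENNReal.ofReal ((n + 1) * (1 - r) ^ n) * g x r) := by
  rw [lintegral_quadrant_eq_lintegral_sum_ratio (H := fun e s => ENNReal.ofReal (Real.exp (-e)) *
    (ENNReal.ofReal (s ^ n * Real.exp (-s) / n.factorial) * g (e + s) (e / (e + s))))]
  · refine setLIntegral_congr_fun measurableSet_Ioi fun x hx => ?_
    refine setLIntegral_congr_fun measurableSet_Ioo fun r hr => ?_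
    have hx' : (0 : ℝ) < x := hx
    have h1 : x * r + x * (1 - r) = x := by ring
    have h2 : x * r / x = r := by field_simp
    have hr1 : 0 < 1 - r := by linarith [hr.2]
    simp only [h1, h2]
    rw [← mul_assoc, ← mul_assoc, ← mul_assoc, ← ENNReal.ofReal_mul hx'.le,
      ← ENNReal.ofReal_mul (by positivity), ← ENNReal.ofReal_mul (by positivity)]
    congr 2
    have h3 : Real.exp (-x) = Real.exp (-(x * r)) * Real.exp (-(x * (1 - r))) := by
      rw [← Real.exp_add]
      congr 1
      ring
    rw [h3, Nat.factorial_succ, mul_pow]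
    push_cast
    field_simp
    ring
  · have hg' : Measurable fun p : ℝ × ℝ => g (p.1 + p.2) (p.1 / (p.1 + p.2)) :=
      hg.comp (f := fun p : ℝ × ℝ => (p.1 + p.2, p.1 / (p.1 + p.2))) (by fun_prop)
    change Measurable fun p : ℝ × ℝ => ENNReal.ofReal (Real.exp (-p.1)) *
      (ENNReal.ofReal (p.2 ^ n * Real.exp (-p.2) / n.factorial) *
        g (p.1 + p.2) (p.1 / (p.1 + p.2)))
    fun_prop

lemma lintegral_beta_pdf (n : ℕ) :
    ∫⁻ r in Ioo (0 : ℝ) 1, ENNReal.ofReal ((n + 1) * (1 - r) ^ n) = 1 := by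
  have h : ∀ r ∈ Icc (0 : ℝ) 1, HasDerivAt (fun r : ℝ => -(1 - r) ^ (n + 1))
      ((n + 1) * (1 - r) ^ n) r := by
    intro r _
    have h1 := (((hasDerivAt_id r).const_sub 1).pow (n + 1)).neg
    refine h1.congr_deriv ?_
    simp
  have hint : ∫ r in (0 : ℝ)..1, ((n : ℝ) + 1) * (1 - r) ^ n = 1 := by
    rw [intervalIntegral.integral_eq_sub_of_hasDerivAt
      (fun r hr => h r (by rwa [uIcc_of_le zero_le_one] at hr))
      (Continuous.intervalIntegrable (by fun_prop) _ _)]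
    simp
  rw [restrict_Ioo_eq_restrict_Ioc]
  rw [← ofReal_integral_eq_lintegral_ofReal, ← intervalIntegral.integral_of_le zero_le_one, hint,
    ENNReal.ofReal_one]
  · exact ((Continuous.intervalIntegrable (by fun_prop) 0 1).1 : IntegrableOn
      (fun r : ℝ => ((n : ℝ) + 1) * (1 - r) ^ n) (Ioc 0 1) volume)
  · refine (ae_restrict_iff' measurableSet_Ioc).mpr (Eventually.of_forall fun r hr => ?_)
    have : 0 ≤ 1 - r := by linarith [hr.2]
    simp only [Pi.zero_apply]
    positivity

/-- Splitting off the first entry of a vector of independent `CN(0, v)` entries, once the total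
gain of the other entries is known to be `Gamma(n + 1, 1)`. -/
lemma lintegral_pi_complexNormal_succ {v : ℝ} (hv : 0 < v) {n : ℕ}
    (hn : ∀ f : ℝ → ℝ≥0∞, Measurable f →
      ∫⁻ z, f (∑ i, ‖z i‖ ^ 2 / v) ∂(Measure.pi fun _ : Fin (n + 1) => complexNormal v) =
        ∫⁻ s in Ioi (0 : ℝ), ENNReal.ofReal (s ^ n * Real.exp (-s) / n.factorial) * f s)
    {F : ℝ → ℝ → ℝ≥0∞} (hF : Measurable (Function.uncurry F)) :
    ∫⁻ z, F (‖z 0‖ ^ 2 / v) (∑ i : Fin (n + 1), ‖z i.succ‖ ^ 2 / v)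
        ∂(Measure.pi fun _ : Fin (n + 2) => complexNormal v) =
      ∫⁻ e in Ioi (0 : ℝ), ∫⁻ s in Ioi (0 : ℝ), ENNReal.ofReal (Real.exp (-e)) *
        (ENNReal.ofReal (s ^ n * Real.exp (-s) / n.factorial) * F e s) := by
  have hmp := measurePreserving_piFinSuccAbove (fun _ : Fin (n + 2) => complexNormal v) 0
  have hF1 : ∀ e, Measurable (F e) := fun e => hF.comp measurable_prodMk_left
  have hG : Measurable fun p : ℂ × (Fin (n + 1) → ℂ) =>
      F (‖p.1‖ ^ 2 / v) (∑ i, ‖p.2 i‖ ^ 2 / v) :=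
    hF.comp (f := fun p : ℂ × (Fin (n + 1) → ℂ) => (‖p.1‖ ^ 2 / v, ∑ i, ‖p.2 i‖ ^ 2 / v))
      (by fun_prop)
  have hG' : Measurable fun e : ℝ => ∫⁻ s in Ioi (0 : ℝ),
      ENNReal.ofReal (s ^ n * Real.exp (-s) / n.factorial) * F e s := by
    refine Measurable.lintegral_prod_right' (f := fun p : ℝ × ℝ =>
      ENNReal.ofReal (p.2 ^ n * Real.exp (-p.2) / n.factorial) * F p.1 p.2) ?_
    have : Measurable fun p : ℝ × ℝ => F p.1 p.2 := hF
    fun_prop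
  calc ∫⁻ z, F (‖z 0‖ ^ 2 / v) (∑ i : Fin (n + 1), ‖z i.succ‖ ^ 2 / v)
        ∂(Measure.pi fun _ : Fin (n + 2) => complexNormal v)
      = ∫⁻ p : ℂ × (Fin (n + 1) → ℂ), F (‖p.1‖ ^ 2 / v) (∑ i, ‖p.2 i‖ ^ 2 / v)
          ∂((complexNormal v).prod (Measure.pi fun _ => complexNormal v)) :=
        hmp.lintegral_comp hG
    _ = ∫⁻ z, ∫⁻ s in Ioi (0 : ℝ), ENNReal.ofReal (s ^ n * Real.exp (-s) / n.factorial) *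
          F (‖z‖ ^ 2 / v) s ∂(volume : Measure ℝ) ∂(complexNormal v) := by
        rw [lintegral_prod _ hG.aemeasurable]
        exact lintegral_congr fun z => hn (F (‖z‖ ^ 2 / v)) (hF1 _)
    _ = _ := by
        rw [lintegral_norm_sq_complexNormal hv hG']
        refine lintegral_congr fun e => ?_
        rw [lintegral_const_mul]
        have := hF1 e
        fun_prop

lemma lintegral_pi_complexNormal {v : ℝ} (hv : 0 < v) (n : ℕ) {f : ℝ → ℝ≥0∞}
    (hf : Measurable f) :
    ∫⁻ z, f (∑ i, ‖z i‖ ^ 2 / v) ∂(Measure.pi fun _ : Fin (n + 1) => complexNormal v) =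
      ∫⁻ x in Ioi (0 : ℝ), ENNReal.ofReal (x ^ n * Real.exp (-x) / n.factorial) * f x := by
  induction n generalizing f with
  | zero =>
    have hmp := measurePreserving_eval (fun _ : Fin 1 => complexNormal v) 0
    have h := hmp.lintegral_comp (f := fun z => f (‖z‖ ^ 2 / v)) (by fun_prop)
    simp only [Function.eval] at h
    simp [h, lintegral_norm_sq_complexNormal hv hf]
  | succ n ih =>
    have hsum : ∀ z : Fin (n + 2) → ℂ, ∑ i, ‖z i‖ ^ 2 / v =
        ‖z 0‖ ^ 2 / v + ∑ i : Fin (n + 1), ‖z i.succ‖ ^ 2 / v := fun z => Fin.sum_univ_succ _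
    simp_rw [hsum]
    rw [lintegral_pi_complexNormal_succ hv (fun f hf => ih hf) (F := fun e s => f (e + s))
      (hf.comp (by fun_prop)),
      lintegral_exp_gamma_eq_lintegral_gamma_beta n (g := fun x _ => f x)
      (hf.comp measurable_fst)]
    refine lintegral_congr fun x => ?_
    rw [lintegral_const_mul _ (by fun_prop), lintegral_mul_const _ (by fun_prop),
      lintegral_beta_pdf, one_mul]

/-! ### Unitary invariance -/

instance isProbabilityMeasure_complexNormalVec (M : ℕ) (v : ℝ) :
    IsProbabilityMeasure (complexNormalVec M v) :=
  Measure.isProbabilityMeasure_map (WithLp.measurable_toLp 2 _).aemeasurable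

lemma charFun_complexNormalVec (M : ℕ) {v : ℝ} (hv : 0 ≤ v) (t : EuclideanSpace ℂ (Fin M)) :
    charFun (complexNormalVec M v) t = Complex.exp (-(v * ‖t‖ ^ 2 / 4 : ℝ)) := by
  rw [complexNormalVec, charFun_pi]
  simp_rw [charFun_complexNormal hv]
  rw [← Complex.exp_sum, EuclideanSpace.norm_sq_eq]
  congr 1
  rw [Finset.mul_sum, Finset.sum_div]
  push_cast
  rw [Finset.sum_neg_distrib]

lemma LinearIsometryEquiv.real_inner_map_map_complex {E F : Type*} [NormedAddCommGroup E]
    [InnerProductSpace ℝ E] [Module ℂ E] [NormedAddCommGroup F] [InnerProductSpace ℝ F]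
    [Module ℂ F] (U : E ≃ₗᵢ[ℂ] F) (x y : E) : inner ℝ (U x) (U y) = inner ℝ x y := by
  rw [real_inner_eq_norm_add_mul_self_sub_norm_mul_self_sub_norm_mul_self_div_two,
    real_inner_eq_norm_add_mul_self_sub_norm_mul_self_sub_norm_mul_self_div_two, ← map_add]
  simp only [LinearIsometryEquiv.norm_map]

/-- The law `CN(0, v I)` is invariant under unitary maps, because its characteristic function
depends on the norm only. -/
lemma map_complexNormalVec (M : ℕ) {v : ℝ} (hv : 0 ≤ v)
    (U : EuclideanSpace ℂ (Fin M) ≃ₗᵢ[ℂ] EuclideanSpace ℂ (Fin M)) :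
    (complexNormalVec M v).map U = complexNormalVec M v := by
  have hU : Measurable U := U.continuous.measurable
  have : IsProbabilityMeasure ((complexNormalVec M v).map U) :=
    Measure.isProbabilityMeasure_map hU.aemeasurable
  refine Measure.ext_of_charFun (funext fun t => ?_)
  rw [charFun_apply, integral_map hU.aemeasurable (by fun_prop)]
  have h : ∀ x, inner ℝ (U x) t = inner ℝ x (U.symm t) := by
    intro x
    rw [← U.real_inner_map_map_complex x, U.apply_symm_apply]
  simp_rw [h]
  rw [← charFun_apply, charFun_complexNormalVec M hv, charFun_complexNormalVec M hv,
    LinearIsometryEquiv.norm_map]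

/-- For a fixed direction `u`, the gain `‖h‖² / v` of `h ∼ CN(0, v I)` and its squared correlation
with `u` are independent, with laws `Gamma(M, 1)` and `Beta(1, M - 1)`.  By unitary invariance `u`
may be taken along the first coordinate axis, where the correlation is the share of the first
entry in the total gain. -/
lemma lintegral_gain_correlation {M : ℕ} (hM : 2 ≤ M) {v : ℝ} (hv : 0 < v)
    {u : EuclideanSpace ℂ (Fin M)} (hu : u ≠ 0) {g : ℝ → ℝ → ℝ≥0∞}
    (hg : Measurable (Function.uncurry g)) :
    ∫⁻ h, g (‖h‖ ^ 2 / v) (‖inner ℂ u h‖ ^ 2 / (‖u‖ ^ 2 * ‖h‖ ^ 2)) ∂(complexNormalVec M v) =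
      ∫⁻ x in Ioi (0 : ℝ), ∫⁻ r in Ioo (0 : ℝ) 1,
        ENNReal.ofReal (x ^ (M - 1) * Real.exp (-x) / (M - 1).factorial) *
          (ENNReal.ofReal (((M : ℝ) - 1) * (1 - r) ^ (M - 2)) * g x r) := by
  obtain ⟨m, rfl⟩ := Nat.exists_eq_add_of_le' hM
  have hu0 : ‖u‖ ≠ 0 := norm_ne_zero_iff.mpr hu
  have hv' := hv.ne'
  obtain ⟨b, hb⟩ := Orthonormal.exists_orthonormalBasis_extension_of_card_eq (𝕜 := ℂ)
    (E := EuclideanSpace ℂ (Fin (m + 2))) (ι := Fin (m + 2)) (by simp)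
    (v := fun _ => ((‖u‖ : ℂ)⁻¹) • u) (s := {0}) (by
      rw [orthonormal_iff_ite]
      rintro ⟨i, rfl⟩ ⟨j, rfl⟩
      simp [norm_smul, hu0])
  have hb0 : b 0 = ((‖u‖ : ℂ)⁻¹) • u := hb 0 rfl
  have hfst : ∀ h, ‖inner ℂ u h‖ ^ 2 / (‖u‖ ^ 2 * ‖h‖ ^ 2) =
      ‖b.repr h 0‖ ^ 2 / ‖b.repr h‖ ^ 2 := by
    intro h
    rw [b.repr_apply_apply, hb0, inner_smul_left, norm_mul, LinearIsometryEquiv.norm_map]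
    simp only [map_inv₀, Complex.conj_ofReal, norm_inv, Complex.norm_real, norm_norm]
    rw [mul_pow, inv_pow]
    rw [div_mul_eq_div_div]
    ring
  have hmeas : Measurable fun h : EuclideanSpace ℂ (Fin (m + 2)) =>
      g (‖h‖ ^ 2 / v) (‖h 0‖ ^ 2 / ‖h‖ ^ 2) :=
    hg.comp (f := fun h : EuclideanSpace ℂ (Fin (m + 2)) =>
      (‖h‖ ^ 2 / v, ‖h 0‖ ^ 2 / ‖h‖ ^ 2)) (by fun_prop)
  calc ∫⁻ h, g (‖h‖ ^ 2 / v) (‖inner ℂ u h‖ ^ 2 / (‖u‖ ^ 2 * ‖h‖ ^ 2))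
        ∂(complexNormalVec (m + 2) v)
      = ∫⁻ h, g (‖b.repr h‖ ^ 2 / v) (‖b.repr h 0‖ ^ 2 / ‖b.repr h‖ ^ 2)
        ∂(complexNormalVec (m + 2) v) := by
        refine lintegral_congr fun h => ?_
        rw [hfst, LinearIsometryEquiv.norm_map]
    _ = ∫⁻ h, g (‖h‖ ^ 2 / v) (‖h 0‖ ^ 2 / ‖h‖ ^ 2) ∂(complexNormalVec (m + 2) v) := by
        conv_rhs => rw [← map_complexNormalVec (m + 2) hv.le b.repr]
        rw [lintegral_map hmeas b.repr.continuous.measurable]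
    _ = ∫⁻ z, g (‖z 0‖ ^ 2 / v + ∑ i : Fin (m + 1), ‖z i.succ‖ ^ 2 / v)
          (‖z 0‖ ^ 2 / v / (‖z 0‖ ^ 2 / v + ∑ i : Fin (m + 1), ‖z i.succ‖ ^ 2 / v))
          ∂(Measure.pi fun _ : Fin (m + 2) => complexNormal v) := by
        rw [complexNormalVec, lintegral_map hmeas (WithLp.measurable_toLp 2 _)]
        refine lintegral_congr fun z => ?_
        rw [EuclideanSpace.norm_sq_eq, ← Finset.sum_div, ← add_div, Fin.sum_univ_succ]
        congr 1
        rw [div_div_div_cancel_right₀ hv']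
    _ = _ := by
        rw [lintegral_pi_complexNormal_succ hv (fun f hf => lintegral_pi_complexNormal hv m hf)
          (F := fun e s => g (e + s) (e / (e + s)))
          (hg.comp (f := fun p : ℝ × ℝ => (p.1 + p.2, p.1 / (p.1 + p.2))) (by fun_prop)),
          lintegral_exp_gamma_eq_lintegral_gamma_beta m hg]
        have h1 : ((m + 2 : ℕ) : ℝ) - 1 = m + 1 := by
          push_cast
          ring
        rw [h1]
        rfl

lemma lintegral_norm_sq_complexNormalVec {M : ℕ} (hM : 1 ≤ M) {v : ℝ} (hv : 0 < v)
    {f : ℝ → ℝ≥0∞} (hf : Measurable f) :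
    ∫⁻ h, f (‖h‖ ^ 2 / v) ∂(complexNormalVec M v) = ∫⁻ x in Ioi (0 : ℝ),
      ENNReal.ofReal (x ^ (M - 1) * Real.exp (-x) / (M - 1).factorial) * f x := by
  obtain ⟨m, rfl⟩ := Nat.exists_eq_add_of_le' hM
  rw [complexNormalVec, lintegral_map (by fun_prop) (WithLp.measurable_toLp 2 _),
    Nat.add_sub_cancel, ← lintegral_pi_complexNormal hv m hf]
  refine lintegral_congr fun z => ?_
  rw [EuclideanSpace.norm_sq_eq, Finset.sum_div]

lemma ae_ne_zero_complexNormalVec {M : ℕ} (hM : 1 ≤ M) {v : ℝ} (hv : 0 < v) :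
    ∀ᵐ h ∂(complexNormalVec M v), h ≠ 0 := by
  have h := lintegral_norm_sq_complexNormalVec hM hv (f := ({0} : Set ℝ).indicator 1)
    (measurable_one.indicator (measurableSet_singleton 0))
  have h0 : ∫⁻ x in Ioi (0 : ℝ), ENNReal.ofReal
      (x ^ (M - 1) * Real.exp (-x) / (M - 1).factorial) * ({0} : Set ℝ).indicator 1 x = 0 := by
    rw [setLIntegral_congr_fun (g := fun _ => 0) measurableSet_Ioi]
    · simp
    · intro x hx
      have : x ≠ 0 := (ne_of_lt hx).symm
      simp [this]
  have hmeas : Measurable fun h : EuclideanSpace ℂ (Fin M) =>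
      ({0} : Set ℝ).indicator (1 : ℝ → ℝ≥0∞) (‖h‖ ^ 2 / v) :=
    (measurable_one.indicator (measurableSet_singleton 0)).comp (by fun_prop)
  rw [h0, lintegral_eq_zero_iff hmeas] at h
  filter_upwards [h] with x hx hx0
  simp [hx0] at hx

namespace JDCCSystem

variable (S : JDCCSystem)

/-! ### The control requirement -/

lemma gammaBarUp_pos : 0 < S.gammaBarUp :=
  div_pos (mul_pos S.Pup_pos S.betaD_pos) (mul_pos S.N0_pos S.Bup_pos)

lemma gammaBarD_pos : 0 < S.gammaBarD :=
  div_pos (mul_pos S.Pdn_pos S.betaD_pos) S.sigmaDn_pos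

lemma one_lt_norm_sq_a : 1 < ‖S.a‖ ^ 2 := one_lt_pow₀ S.one_lt_a two_ne_zero

lemma etaV_pos {Vreq : ℝ} (hV : S.noiseVar < Vreq) : 0 < S.etaV Vreq := by
  have hN := S.noiseVar_pos
  have hα := S.alphaUp_pos
  have ha := S.one_lt_norm_sq_a
  have h1 : 1 < ‖S.a‖ ^ 2 * Vreq / (Vreq - S.noiseVar) := by
    rw [one_lt_div (by linarith)]
    nlinarith
  have h2 : 1 < (‖S.a‖ ^ 2 * Vreq / (Vreq - S.noiseVar)) ^ (1 / S.alphaUp) :=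
    Real.one_lt_rpow h1 (by positivity)
  exact mul_pos (one_div_pos.mpr S.gammaBarUp_pos) (by linarith)

lemma etaV_lt_iff {Vreq x : ℝ} (hV : S.noiseVar < Vreq) (hx : 0 ≤ x) :
    S.etaV Vreq < x ↔
      0 < S.uplinkQuality x * (Vreq - S.noiseVar) - ‖S.a‖ ^ 2 * Vreq := by
  have hN := S.noiseVar_pos
  have hγ := S.gammaBarUp_pos
  have hα := S.alphaUp_pos
  have hb : 0 ≤ ‖S.a‖ ^ 2 * Vreq / (Vreq - S.noiseVar) :=
    div_nonneg (mul_nonneg (by positivity) (by linarith)) (by linarith)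
  rw [etaV, one_div, inv_mul_lt_iff₀ hγ, sub_lt_iff_lt_add', one_div,
    Real.rpow_inv_lt_iff_of_pos hb (by positivity) hα, ← uplinkQuality,
    div_lt_iff₀ (by linarith), sub_pos]

lemma one_le_uplinkQuality {x : ℝ} (hx : 0 ≤ x) : 1 ≤ S.uplinkQuality x :=
  Real.one_le_rpow (by nlinarith [S.gammaBarUp_pos]) S.alphaUp_pos.le

lemma gammaDReq_pos {Vreq x : ℝ} (hV : S.noiseVar < Vreq) (hx : S.etaV Vreq < x) :
    0 < S.gammaDReq Vreq x := by
  have hN := S.noiseVar_pos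
  have hx0 : 0 ≤ x := ((S.etaV_pos hV).trans hx).le
  have hΔ := (S.etaV_lt_iff hV hx0).mp hx
  have hS := S.one_le_uplinkQuality hx0
  have ha := S.one_lt_norm_sq_a
  have hα := S.alphaDn_pos
  have h1 : 1 < ‖S.a‖ ^ 2 * Vreq * (S.uplinkQuality x - 1) /
      (S.uplinkQuality x * (Vreq - S.noiseVar) - ‖S.a‖ ^ 2 * Vreq) := by
    rw [one_lt_div hΔ]
    have h2 : 0 < S.uplinkQuality x * ((‖S.a‖ ^ 2 - 1) * Vreq + S.noiseVar) :=
      mul_pos (by linarith) (by nlinarith)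
    linarith
  have h2 := Real.one_lt_rpow h1 (one_div_pos.mpr hα)
  rw [gammaDReq]
  linarith

lemma etaF_pos {Vreq x : ℝ} (hV : S.noiseVar < Vreq) (hx : S.etaV Vreq < x) :
    0 < S.etaF Vreq x := div_pos (S.gammaDReq_pos hV hx) S.gammaBarD_pos

/-- The control requirement `c V ≤ V - σ²`, solved for the uplink gain `x` and the downlink SINR
`d`: the first condition makes the denominator in `gammaDReq` positive. -/
lemma loopGain_mul_le_iff {Vreq x d : ℝ} (hV : S.noiseVar < Vreq) (hx : 0 ≤ x) (hd : 0 ≤ d) :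
    S.loopGain (S.gammaBarUp * x) d * Vreq ≤ Vreq - S.noiseVar ↔
      S.etaV Vreq < x ∧ S.gammaDReq Vreq x ≤ d := by
  have hN := S.noiseVar_pos
  have ha := S.one_lt_norm_sq_a
  have hα := S.alphaDn_pos
  have hS := S.one_le_uplinkQuality hx
  have hγx : 0 ≤ S.gammaBarUp * x := mul_nonneg S.gammaBarUp_pos.le hx
  have hT : 0 < (1 + d) ^ S.alphaDn := by positivity
  have hΔ := S.etaV_lt_iff hV hx
  have hgain : S.loopGain (S.gammaBarUp * x) d * Vreq ≤ Vreq - S.noiseVar ↔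
      ‖S.a‖ ^ 2 * Vreq * (S.uplinkQuality x - 1) ≤
        (1 + d) ^ S.alphaDn * (S.uplinkQuality x * (Vreq - S.noiseVar) - ‖S.a‖ ^ 2 * Vreq) := by
    rw [loopGain, Real.rpow_neg (by linarith), Real.rpow_neg (by linarith), ← uplinkQuality]
    set Q := S.uplinkQuality x
    set T := (1 + d) ^ S.alphaDn
    have hQ : 0 < Q := by linarith
    have h : Q * T * (‖S.a‖ ^ 2 * (Q⁻¹ + (1 - Q⁻¹) * T⁻¹) * Vreq) =
        ‖S.a‖ ^ 2 * Vreq * T + ‖S.a‖ ^ 2 * Vreq * (Q - 1) := by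
      field_simp
    rw [← mul_le_mul_iff_right₀ (mul_pos hQ hT), h]
    constructor <;> intro <;> linarith
  have hreq : 0 < S.uplinkQuality x * (Vreq - S.noiseVar) - ‖S.a‖ ^ 2 * Vreq →
      (S.gammaDReq Vreq x ≤ d ↔ ‖S.a‖ ^ 2 * Vreq * (S.uplinkQuality x - 1) ≤
        (1 + d) ^ S.alphaDn * (S.uplinkQuality x * (Vreq - S.noiseVar) - ‖S.a‖ ^ 2 * Vreq)) := by
    intro h
    have hb : 0 ≤ ‖S.a‖ ^ 2 * Vreq * (S.uplinkQuality x - 1) /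
        (S.uplinkQuality x * (Vreq - S.noiseVar) - ‖S.a‖ ^ 2 * Vreq) :=
      div_nonneg (mul_nonneg (mul_nonneg (by positivity) (by linarith)) (by linarith)) h.le
    rw [gammaDReq, sub_le_iff_le_add', one_div, Real.rpow_inv_le_iff_of_pos hb (by linarith) hα,
      div_le_iff₀ h]
  rw [hgain, hΔ]
  constructor
  · intro h
    have hpos : 0 < S.uplinkQuality x * (Vreq - S.noiseVar) - ‖S.a‖ ^ 2 * Vreq := by
      rcases hS.eq_or_lt with h1 | h1
      · -- A useless uplink cannot meet the requirement, since the plant is unstable.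
        rw [← h1] at h
        have : 0 < (1 + d) ^ S.alphaDn * ((‖S.a‖ ^ 2 - 1) * Vreq + S.noiseVar) :=
          mul_pos hT (by nlinarith)
        linarith
      · refine pos_of_mul_pos_right (lt_of_lt_of_le ?_ h) hT.le
        exact mul_pos (mul_pos (by linarith) (by linarith)) (by linarith)
    exact ⟨hpos, (hreq hpos).mpr h⟩
  · rintro ⟨h1, h2⟩
    exact (hreq h1).mp h2

/-! ### Zero-forcing beams -/

lemma inner_nullProj {h : S.Vec} (hh : h ≠ 0) (v : S.Vec) : inner ℂ h (S.nullProj h v) = 0 := by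
  have h0 : (‖h‖ : ℂ) ≠ 0 := by
    simpa using hh
  rw [nullProj, inner_sub_right, inner_smul_right, inner_self_eq_norm_sq_to_K]
  simp
  field_simp
  ring

lemma inner_self_nullProj {h : S.Vec} (hh : h ≠ 0) (v : S.Vec) :
    inner ℂ v (S.nullProj h v) = (‖S.nullProj h v‖ : ℂ) ^ 2 := by
  have hv : v = S.nullProj h v + (inner ℂ h v / (‖h‖ : ℂ) ^ 2) • h := by
    rw [nullProj, sub_add_cancel]
  conv_lhs => rw [hv]
  rw [inner_add_left, inner_smul_left]
  rw [← hv, S.inner_nullProj hh, mul_zero, add_zero, inner_self_eq_norm_sq_to_K]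
  rfl

lemma norm_sq_nullProj {h : S.Vec} (hh : h ≠ 0) {v : S.Vec} (hv : v ≠ 0) :
    ‖S.nullProj h v‖ ^ 2 = ‖v‖ ^ 2 * (1 - ‖inner ℂ h v‖ ^ 2 / (‖h‖ ^ 2 * ‖v‖ ^ 2)) := by
  have h0 : ‖h‖ ≠ 0 := norm_ne_zero_iff.mpr hh
  have hv0 : ‖v‖ ≠ 0 := norm_ne_zero_iff.mpr hv
  have key := S.inner_self_nullProj hh v
  have hc : inner ℂ v h * inner ℂ h v = ((‖inner ℂ h v‖ ^ 2 : ℝ) : ℂ) := by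
    rw [← inner_conj_symm v h, mul_comm, Complex.mul_conj, Complex.normSq_eq_norm_sq]
  have h2 : inner ℂ v (S.nullProj h v) =
      ((‖v‖ ^ 2 - ‖inner ℂ h v‖ ^ 2 / ‖h‖ ^ 2 : ℝ) : ℂ) := by
    rw [nullProj, inner_sub_right, inner_smul_right, inner_self_eq_norm_sq_to_K, div_mul_eq_mul_div,
      mul_comm (inner ℂ h v), hc]
    push_cast
    rfl
  rw [h2] at key
  have h3 : ‖v‖ ^ 2 - ‖inner ℂ h v‖ ^ 2 / ‖h‖ ^ 2 = ‖S.nullProj h v‖ ^ 2 := by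
    exact_mod_cast key
  rw [← h3]
  field_simp

lemma inner_zfBeam_null {h h' : S.Vec} (hh : h' ≠ 0) (p : ℝ) :
    inner ℂ h' (S.zfBeam p h h') = 0 := by
  rw [zfBeam, inner_smul_right, S.inner_nullProj hh, mul_zero]

lemma norm_sq_inner_zfBeam {h h' : S.Vec} (hh : h' ≠ 0) {p : ℝ} (hp : 0 ≤ p) :
    ‖inner ℂ h (S.zfBeam p h h')‖ ^ 2 = p * ‖S.nullProj h' h‖ ^ 2 := by
  rw [zfBeam, inner_smul_right, S.inner_self_nullProj hh, norm_mul, Complex.norm_real, norm_pow,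
    Complex.norm_real, norm_norm, Real.norm_eq_abs, mul_pow, sq_abs, div_pow, Real.sq_sqrt hp]
  rcases eq_or_ne ‖S.nullProj h' h‖ 0 with h0 | h0
  · simp [h0]
  · field_simp

/-! ### The success region -/

/-- The set of triples `(x, r, y)` of normalized control gain, squared correlation and normalized
communication gain for which zero forcing succeeds. -/
def successRegion (τreq Vreq : ℝ) : Set (ℝ × ℝ × ℝ) :=
  {p | S.etaV Vreq < p.1 ∧ 0 < (1 - p.2.1) * p.1 - S.etaF Vreq p.1 ∧
    S.phi τreq Vreq p.1 p.2.1 ≤ p.2.2}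

/-- Two rate requirements can be met by splitting the power `P` iff the powers they need add up to
at most `P`. -/
lemma exists_power_split_iff {P γU γD A B : ℝ} (hγU : 0 < γU) (hγD : 0 < γD)
    (hA : 0 ≤ A) (hB : 0 ≤ B) :
    (∃ p ∈ Icc 0 P, γU ≤ (P - p) * B ∧ γD ≤ p * A) ↔
      γD < P * A ∧ γU * A ≤ B * (P * A - γD) := by
  constructor
  · rintro ⟨p, ⟨hp0, hp1⟩, h1, h2⟩
    have hA' : 0 < A := hA.lt_of_ne fun h => by
      rw [← h] at h2
      linarith
    have hp : 0 < P - p := pos_of_mul_pos_left (hγU.trans_le h1) hB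
    refine ⟨by nlinarith, ?_⟩
    have h3 := mul_le_mul_of_nonneg_right h1 hA
    have h4 := mul_le_mul_of_nonneg_left h2 hB
    nlinarith
  · rintro ⟨h1, h2⟩
    have hA' : 0 < A := hA.lt_of_ne fun h => by
      rw [← h] at h1
      linarith
    refine ⟨γD / A, ⟨by positivity, (div_le_iff₀ hA').mpr h1.le⟩, ?_, ?_⟩
    · rw [← mul_le_mul_iff_left₀ hA']
      have : (P - γD / A) * B * A = B * (P * A - γD) := by
        field_simp
      linarith
    · rw [div_mul_cancel₀ _ hA'.ne']

lemma zfSuccess_iff {τreq Vreq : ℝ} (hτ : 0 < τreq) (hV : S.noiseVar < Vreq) {hD hU : S.Vec}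
    (hD0 : hD ≠ 0) (hU0 : hU ≠ 0) :
    S.ZFSuccess τreq Vreq hD hU ↔
      (‖hD‖ ^ 2 / S.betaD, ‖inner ℂ hU hD‖ ^ 2 / (‖hU‖ ^ 2 * ‖hD‖ ^ 2), ‖hU‖ ^ 2 / S.betaU) ∈
        S.successRegion τreq Vreq := by
  have hσ := S.sigmaDn_pos
  have hβD := S.betaD_pos
  have hβU := S.betaU_pos
  have hP := S.Pdn_pos
  have hγU := S.gammaUReq_pos hτ
  have hnD : 0 < ‖hD‖ := norm_pos_iff.mpr hD0
  have hnU : 0 < ‖hU‖ := norm_pos_iff.mpr hU0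
  set x := ‖hD‖ ^ 2 / S.betaD with hx
  set y := ‖hU‖ ^ 2 / S.betaU with hy
  set r := ‖inner ℂ hU hD‖ ^ 2 / (‖hU‖ ^ 2 * ‖hD‖ ^ 2) with hr
  have hx0 : 0 < x := by positivity
  have hy0 : 0 < y := by positivity
  have hNU : ‖S.nullProj hU hD‖ ^ 2 = S.betaD * x * (1 - r) := by
    rw [S.norm_sq_nullProj hU0 hD0, ← hr, hx]
    field_simp
  have hND : ‖S.nullProj hD hU‖ ^ 2 = S.betaU * y * (1 - r) := by
    have hr' : ‖inner ℂ hD hU‖ ^ 2 / (‖hD‖ ^ 2 * ‖hU‖ ^ 2) = r := by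
      rw [hr, norm_inner_symm, mul_comm]
    rw [S.norm_sq_nullProj hD0 hU0, hr', hy]
    field_simp
  have hr1 : 0 ≤ 1 - r := by
    have h : 0 ≤ S.betaD * x * (1 - r) := hNU ▸ sq_nonneg _
    exact nonneg_of_mul_nonneg_right h (by positivity)
  have hsnr : S.snrUp hD = S.gammaBarUp * x := by
    rw [snrUp, gammaBarUp, hx]
    field_simp
  -- `A` and `B` are the SINRs of the device and of the user per unit of downlink power.
  set A := S.betaD * x * (1 - r) / S.sigmaDn with hA
  set B := S.betaU * y * (1 - r) / S.sigmaDn with hB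
  have hA0 : 0 ≤ A := by positivity
  have hB0 : 0 ≤ B := by positivity
  have hsplit : S.ZFSuccess τreq Vreq hD hU ↔ S.etaV Vreq < x ∧
      ∃ p ∈ Icc 0 S.Pdn, S.gammaUReq τreq ≤ (S.Pdn - p) * B ∧ S.gammaDReq Vreq x ≤ p * A := by
    have hiff : ∀ p ∈ Icc 0 S.Pdn,
        ((S.delay (S.sinrDn hU (S.zfBeam (S.Pdn - p) hU hD) (S.zfBeam p hD hU)) ≤
          ENNReal.ofReal τreq ∧
        S.steadyVar (S.snrUp hD) (S.sinrDn hD (S.zfBeam p hD hU) (S.zfBeam (S.Pdn - p) hU hD)) ≤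
          ENNReal.ofReal Vreq) ↔
        S.gammaUReq τreq ≤ (S.Pdn - p) * B ∧ S.etaV Vreq < x ∧ S.gammaDReq Vreq x ≤ p * A) := by
      rintro p ⟨hp0, hp1⟩
      rw [S.delay_le_iff (S.sinrDn_nonneg _ _ _) hτ,
        S.steadyVar_le_iff (S.snrUp_nonneg _) (S.sinrDn_nonneg _ _ _) hV, hsnr,
        S.loopGain_mul_le_iff hV hx0.le (S.sinrDn_nonneg _ _ _)]
      have h1 : S.sinrDn hU (S.zfBeam (S.Pdn - p) hU hD) (S.zfBeam p hD hU) =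
          (S.Pdn - p) * B := by
        rw [sinrDn, S.norm_sq_inner_zfBeam hD0 (by linarith), S.inner_zfBeam_null hU0, hND]
        simp [hB, mul_div_assoc]
      have h2 : S.sinrDn hD (S.zfBeam p hD hU) (S.zfBeam (S.Pdn - p) hU hD) = p * A := by
        rw [sinrDn, S.norm_sq_inner_zfBeam hU0 hp0, S.inner_zfBeam_null hD0, hNU]
        simp [hA, mul_div_assoc]
      rw [h1, h2]
    constructor
    · rintro ⟨p, hp, h⟩
      obtain ⟨h1, h2, h3⟩ := (hiff p hp).mp h
      exact ⟨h2, p, hp, h1, h3⟩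
    · rintro ⟨h2, p, hp, h1, h3⟩
      exact ⟨p, hp, (hiff p hp).mpr ⟨h1, h2, h3⟩⟩
  rw [hsplit, successRegion, mem_ofPred_eq]
  refine and_congr_right fun hxV => ?_
  have hγD := S.gammaDReq_pos hV hxV
  rw [exists_power_split_iff hγU hγD hA0 hB0]
  have hden : (1 - r) * x - S.etaF Vreq x =
      S.sigmaDn / (S.Pdn * S.betaD) * (S.Pdn * A - S.gammaDReq Vreq x) := by
    rw [etaF, gammaBarD, hA]
    field_simp
  have hpos : 0 < (1 - r) * x - S.etaF Vreq x ↔ S.gammaDReq Vreq x < S.Pdn * A := by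
    rw [hden, mul_pos_iff_of_pos_left (by positivity), sub_pos]
  rw [hpos]
  refine and_congr_right fun hlt => ?_
  have hr0 : 0 < 1 - r := hr1.lt_of_ne fun h => by
    rw [hA, ← h] at hlt
    simp at hlt
    linarith
  simp only
  rw [phi, div_le_iff₀ (hpos.mpr hlt), hden, etaU]
  have hc : 0 < S.sigmaDn ^ 2 / (S.Pdn * S.betaU * S.betaD) := by positivity
  rw [← mul_le_mul_iff_right₀ hc, ← mul_le_mul_iff_left₀ (b := _ * x) hr0]
  have e1 : S.sigmaDn ^ 2 / (S.Pdn * S.betaU * S.betaD) * (S.gammaUReq τreq * A) =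
      S.gammaUReq τreq * S.sigmaDn / (S.Pdn * S.betaU) * x * (1 - r) := by
    rw [hA]
    field_simp
  have e2 : S.sigmaDn ^ 2 / (S.Pdn * S.betaU * S.betaD) *
      (B * (S.Pdn * A - S.gammaDReq Vreq x)) =
      y * (S.sigmaDn / (S.Pdn * S.betaD) * (S.Pdn * A - S.gammaDReq Vreq x)) * (1 - r) := by
    rw [hB]
    field_simp
  rw [e1, e2]

end JDCCSystem

/-! ### Tails of the Gamma distribution -/

lemma hasDerivAt_neg_exp_mul_sum (n : ℕ) (y : ℝ) :
    HasDerivAt (fun y : ℝ => -(Real.exp (-y) * ∑ k ∈ Finset.range (n + 1), y ^ k / k.factorial))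
      (y ^ n * Real.exp (-y) / n.factorial) y := by
  have hexp : HasDerivAt (fun y : ℝ => Real.exp (-y)) (-Real.exp (-y)) y := by
    simpa using (hasDerivAt_neg y).exp
  induction n with
  | zero => simpa using hexp.fun_neg
  | succ n ih =>
    have h := ih.fun_add ((hexp.fun_mul ((hasDerivAt_pow (n + 1) y).div_const
      ((n + 1).factorial : ℝ))).fun_neg)
    have hfun : (fun y : ℝ => -(Real.exp (-y) * ∑ k ∈ Finset.range (n + 1 + 1),
        y ^ k / k.factorial)) = fun y => -(Real.exp (-y) * ∑ k ∈ Finset.range (n + 1),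
        y ^ k / k.factorial) + -(Real.exp (-y) * (y ^ (n + 1) / (n + 1).factorial)) := by
      funext z
      rw [Finset.sum_range_succ _ (n + 1)]
      ring
    rw [hfun]
    refine h.congr_deriv ?_
    rw [Nat.factorial_succ]
    push_cast
    have : (n.factorial : ℝ) ≠ 0 := by positivity
    field_simp
    simp

lemma lintegral_Ioi_gamma_pdf (n : ℕ) {t : ℝ} (ht : 0 ≤ t) :
    ∫⁻ y in Ioi t, ENNReal.ofReal (y ^ n * Real.exp (-y) / n.factorial) =
      ENNReal.ofReal (Real.exp (-t) * ∑ k ∈ Finset.range (n + 1), t ^ k / k.factorial) := by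
  have hlim : Tendsto (fun y : ℝ => -(Real.exp (-y) * ∑ k ∈ Finset.range (n + 1),
      y ^ k / k.factorial)) atTop (𝓝 0) := by
    have h : Tendsto (fun y : ℝ => -∑ k ∈ Finset.range (n + 1),
        y ^ k * Real.exp (-y) / k.factorial) atTop
        (𝓝 (-∑ k ∈ Finset.range (n + 1), 0 / (k.factorial : ℝ))) :=
      (tendsto_finsetSum _ fun k _ =>
        (Real.tendsto_pow_mul_exp_neg_atTop_nhds_zero k).div_const _).neg
    simp only [zero_div, Finset.sum_const_zero, neg_zero] at h
    refine h.congr fun y => ?_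
    rw [Finset.mul_sum]
    congr 1
    refine Finset.sum_congr rfl fun k _ => ?_
    ring
  have hderiv : ∀ y ∈ Ici t, HasDerivAt (fun y : ℝ => -(Real.exp (-y) *
      ∑ k ∈ Finset.range (n + 1), y ^ k / k.factorial))
      (y ^ n * Real.exp (-y) / n.factorial) y := fun y _ => hasDerivAt_neg_exp_mul_sum n y
  have hnonneg : ∀ y ∈ Ioi t, 0 ≤ y ^ n * Real.exp (-y) / n.factorial := by
    intro y hy
    have : 0 < y := ht.trans_lt hy
    positivity
  rw [← ofReal_integral_eq_lintegral_ofReal (integrableOn_Ioi_deriv_of_nonneg' hderiv hnonneg hlim)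
    ((ae_restrict_iff' measurableSet_Ioi).mpr (Eventually.of_forall hnonneg)),
    integral_Ioi_of_hasDerivAt_of_nonneg' hderiv hnonneg hlim]
  simp

namespace JDCCSystem

variable (S : JDCCSystem)

lemma gainPDF_nonneg {x : ℝ} (hx : 0 ≤ x) : 0 ≤ S.gainPDF x := by
  rw [gainPDF]
  positivity

lemma corrPDF_nonneg {r : ℝ} (hr : r ≤ 1) : 0 ≤ S.corrPDF r := by
  have hM : (2 : ℝ) ≤ S.M := by exact_mod_cast S.two_le_M
  have : 0 ≤ 1 - r := by linarith
  exact mul_nonneg (by linarith) (by positivity)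

lemma corrPDF_le {r : ℝ} (hr0 : 0 ≤ r) (hr : r ≤ 1) : S.corrPDF r ≤ S.M - 1 := by
  have hM : (2 : ℝ) ≤ S.M := by exact_mod_cast S.two_le_M
  exact mul_le_of_le_one_right (by linarith) (pow_le_one₀ (by linarith) (by linarith))

lemma one_sub_gainCDF_nonneg {t : ℝ} (ht : 0 ≤ t) : 0 ≤ 1 - S.gainCDF t := by
  rw [gainCDF, sub_sub_cancel]
  positivity

lemma one_sub_gainCDF_le_one {t : ℝ} (ht : 0 ≤ t) : 1 - S.gainCDF t ≤ 1 := by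
  rw [gainCDF, sub_sub_cancel]
  calc Real.exp (-t) * ∑ k ∈ Finset.range S.M, t ^ k / (k.factorial : ℝ)
      ≤ Real.exp (-t) * Real.exp t :=
        mul_le_mul_of_nonneg_left (Real.sum_le_exp_of_nonneg ht _) (Real.exp_pos _).le
    _ = 1 := by rw [← Real.exp_add, neg_add_cancel, Real.exp_zero]

lemma lintegral_Ioi_gainPDF {t : ℝ} (ht : 0 ≤ t) :
    ∫⁻ y in Ioi t, ENNReal.ofReal (S.gainPDF y) = ENNReal.ofReal (1 - S.gainCDF t) := by
  have hM : S.M - 1 + 1 = S.M := Nat.sub_add_cancel (one_le_two.trans S.two_le_M)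
  have h := lintegral_Ioi_gamma_pdf (S.M - 1) ht
  rw [hM] at h
  rw [gainCDF, sub_sub_cancel]
  exact h

/-! ### Measurability -/

@[fun_prop]
lemma measurable_etaF (Vreq : ℝ) : Measurable (S.etaF Vreq) := by
  unfold etaF gammaDReq uplinkQuality
  fun_prop

@[fun_prop]
lemma measurable_gainPDF : Measurable S.gainPDF := by
  unfold gainPDF
  fun_prop

@[fun_prop]
lemma measurable_corrPDF : Measurable S.corrPDF := by
  unfold corrPDF
  fun_prop

@[fun_prop]
lemma measurable_gainCDF : Measurable S.gainCDF := by
  unfold gainCDF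
  fun_prop

@[fun_prop]
lemma measurable_zfUpper (Vreq : ℝ) : Measurable (S.zfUpper Vreq) := by
  unfold zfUpper
  fun_prop

lemma measurable_phi (τreq Vreq : ℝ) :
    Measurable fun p : ℝ × ℝ => S.phi τreq Vreq p.1 p.2 := by
  unfold phi
  fun_prop

lemma measurable_zfIntegrand (τreq Vreq : ℝ) :
    Measurable fun p : ℝ × ℝ => S.zfIntegrand τreq Vreq p.1 p.2 := by
  have := S.measurable_phi τreq Vreq
  unfold zfIntegrand
  fun_prop

lemma measurableSet_successRegion (τreq Vreq : ℝ) :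
    MeasurableSet (S.successRegion τreq Vreq) := by
  have hphi : Measurable fun p : ℝ × ℝ × ℝ => S.phi τreq Vreq p.1 p.2.1 :=
    (S.measurable_phi τreq Vreq).comp (measurable_fst.prodMk (measurable_fst.comp measurable_snd))
  have hden : Measurable fun p : ℝ × ℝ × ℝ => (1 - p.2.1) * p.1 - S.etaF Vreq p.1 := by fun_prop
  have h1 : MeasurableSet {p : ℝ × ℝ × ℝ | S.etaV Vreq < p.1} :=
    measurableSet_lt measurable_const measurable_fst
  have h2 : MeasurableSet {p : ℝ × ℝ × ℝ | 0 < (1 - p.2.1) * p.1 - S.etaF Vreq p.1} :=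
    measurableSet_lt measurable_const hden
  have h3 : MeasurableSet {p : ℝ × ℝ × ℝ | S.phi τreq Vreq p.1 p.2.1 ≤ p.2.2} :=
    measurableSet_le hphi (measurable_snd.comp measurable_snd)
  exact h1.inter (h2.inter h3)

/-! ### The closed form -/

lemma etaU_pos {τreq : ℝ} (hτ : 0 < τreq) : 0 < S.etaU τreq :=
  div_pos (mul_pos (S.gammaUReq_pos hτ) S.sigmaDn_pos) (mul_pos S.Pdn_pos S.betaU_pos)

lemma zfUpper_nonneg (Vreq x : ℝ) : 0 ≤ S.zfUpper Vreq x := le_max_right _ _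

lemma zfUpper_lt_one {Vreq x : ℝ} (hV : S.noiseVar < Vreq) (hx : S.etaV Vreq < x) :
    S.zfUpper Vreq x < 1 := by
  have hx0 := (S.etaV_pos hV).trans hx
  have := div_pos (S.etaF_pos hV hx) hx0
  exact max_lt (by linarith) one_pos

lemma lt_zfUpper_iff {Vreq x r : ℝ} (hx : 0 < x) (hr : 0 < r) :
    r < S.zfUpper Vreq x ↔ 0 < (1 - r) * x - S.etaF Vreq x := by
  rw [zfUpper, lt_max_iff, or_iff_left (by linarith), lt_sub_comm, div_lt_iff₀ hx, sub_pos]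

lemma phi_pos {τreq Vreq x r : ℝ} (hτ : 0 < τreq) (hx : 0 < x)
    (h : 0 < (1 - r) * x - S.etaF Vreq x) : 0 < S.phi τreq Vreq x r :=
  div_pos (mul_pos (S.etaU_pos hτ) hx) h

lemma zfIntegrand_nonneg {τreq Vreq x r : ℝ} (hτ : 0 < τreq) (hV : S.noiseVar < Vreq)
    (hx : S.etaV Vreq < x) (hr : r ∈ Ioo 0 (S.zfUpper Vreq x)) :
    0 ≤ S.zfIntegrand τreq Vreq x r := by
  have hx0 := (S.etaV_pos hV).trans hx
  have hphi := S.phi_pos hτ hx0 ((S.lt_zfUpper_iff hx0 hr.1).mp hr.2)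
  exact mul_nonneg (mul_nonneg (S.gainPDF_nonneg hx0.le)
    (S.corrPDF_nonneg (hr.2.trans (S.zfUpper_lt_one hV hx)).le))
    (S.one_sub_gainCDF_nonneg hphi.le)

lemma integrableOn_zfIntegrand {τreq Vreq x : ℝ} (hτ : 0 < τreq) (hV : S.noiseVar < Vreq)
    (hx : S.etaV Vreq < x) :
    IntegrableOn (fun r => S.zfIntegrand τreq Vreq x r) (Ioo 0 (S.zfUpper Vreq x)) volume := by
  have hx0 := (S.etaV_pos hV).trans hx
  refine Measure.integrableOn_of_bounded (M := S.gainPDF x * (S.M - 1)) (by simp)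
    ((S.measurable_zfIntegrand τreq Vreq).comp measurable_prodMk_left).aestronglyMeasurable ?_
  refine (ae_restrict_iff' measurableSet_Ioo).mpr (Eventually.of_forall fun r hr => ?_)
  rw [Real.norm_eq_abs, abs_of_nonneg (S.zfIntegrand_nonneg hτ hV hx hr)]
  have hr1 := (hr.2.trans (S.zfUpper_lt_one hV hx)).le
  have hphi := S.phi_pos hτ hx0 ((S.lt_zfUpper_iff hx0 hr.1).mp hr.2)
  have hG := S.gainPDF_nonneg hx0.le
  calc S.zfIntegrand τreq Vreq x r ≤ S.gainPDF x * S.corrPDF r :=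
        mul_le_of_le_one_right (mul_nonneg hG (S.corrPDF_nonneg hr1))
          (S.one_sub_gainCDF_le_one hphi.le)
    _ ≤ _ := mul_le_mul_of_nonneg_left (S.corrPDF_le hr.1.le hr1) hG

/-- The inner integral of the closed form, as a Lebesgue integral of a nonnegative function. -/
noncomputable def innerLIntegral (τreq Vreq x : ℝ) : ℝ≥0∞ :=
  ∫⁻ r in Ioo 0 (S.zfUpper Vreq x), ENNReal.ofReal (S.zfIntegrand τreq Vreq x r)

lemma measurable_innerLIntegral (τreq Vreq : ℝ) : Measurable (S.innerLIntegral τreq Vreq) := by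
  have h : ∀ x, S.innerLIntegral τreq Vreq x = ∫⁻ r, {p : ℝ × ℝ | 0 < p.2 ∧
      p.2 < S.zfUpper Vreq p.1}.indicator
        (fun p => ENNReal.ofReal (S.zfIntegrand τreq Vreq p.1 p.2)) (x, r) := by
    intro x
    rw [innerLIntegral, ← lintegral_indicator measurableSet_Ioo]
    rfl
  rw [funext h]
  refine Measurable.lintegral_prod_right' (f := fun p : ℝ × ℝ => {p : ℝ × ℝ | 0 < p.2 ∧
      p.2 < S.zfUpper Vreq p.1}.indicator
        (fun p => ENNReal.ofReal (S.zfIntegrand τreq Vreq p.1 p.2)) p) ?_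
  have h1 : MeasurableSet {p : ℝ × ℝ | 0 < p.2} := measurableSet_lt measurable_const measurable_snd
  have h2 : MeasurableSet {p : ℝ × ℝ | p.2 < S.zfUpper Vreq p.1} :=
    measurableSet_lt measurable_snd ((S.measurable_zfUpper Vreq).comp measurable_fst)
  exact (S.measurable_zfIntegrand τreq Vreq).ennreal_ofReal.indicator (h1.inter h2)

lemma integral_zfIntegrand {τreq Vreq x : ℝ} (hτ : 0 < τreq) (hV : S.noiseVar < Vreq)
    (hx : S.etaV Vreq < x) :
    ∫ r in (0 : ℝ)..(S.zfUpper Vreq x), S.zfIntegrand τreq Vreq x r =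
      (S.innerLIntegral τreq Vreq x).toReal := by
  rw [intervalIntegral.integral_of_le (S.zfUpper_nonneg _ _), integral_Ioc_eq_integral_Ioo,
    innerLIntegral, integral_eq_lintegral_of_nonneg_ae
      ((ae_restrict_iff' measurableSet_Ioo).mpr
        (Eventually.of_forall fun r hr => S.zfIntegrand_nonneg hτ hV hx hr))
      (S.integrableOn_zfIntegrand hτ hV hx).aestronglyMeasurable]

/-- Integrating out the normalized communication gain over the success region. -/
lemma lintegral_successRegion_section {τreq Vreq x r : ℝ} (hτ : 0 < τreq) (hx : 0 < x) :
    ∫⁻ y in Ioi (0 : ℝ), ENNReal.ofReal (S.gainPDF y) *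
        (S.successRegion τreq Vreq).indicator 1 (x, r, y) =
      {p : ℝ × ℝ | S.etaV Vreq < p.1 ∧ 0 < (1 - p.2) * p.1 - S.etaF Vreq p.1}.indicator
        (fun p => ENNReal.ofReal (1 - S.gainCDF (S.phi τreq Vreq p.1 p.2))) (x, r) := by
  by_cases h : S.etaV Vreq < x ∧ 0 < (1 - r) * x - S.etaF Vreq x
  · have hphi := S.phi_pos hτ hx h.2
    have htail : ENNReal.ofReal (1 - S.gainCDF (S.phi τreq Vreq x r)) =
        ∫⁻ y in Ici (S.phi τreq Vreq x r), ENNReal.ofReal (S.gainPDF y) := by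
      rw [← S.lintegral_Ioi_gainPDF hphi.le, setLIntegral_congr Ioi_ae_eq_Ici]
    rw [indicator_of_mem (by exact h), htail, ← lintegral_indicator measurableSet_Ioi,
      ← lintegral_indicator measurableSet_Ici]
    refine lintegral_congr fun y => ?_
    by_cases hy : S.phi τreq Vreq x r ≤ y
    · have hy0 : 0 < y := hphi.trans_le hy
      have hmem : (x, r, y) ∈ S.successRegion τreq Vreq := ⟨h.1, h.2, hy⟩
      rw [indicator_of_mem (show y ∈ Ioi 0 from hy0), indicator_of_mem hmem,
        indicator_of_mem (show y ∈ Ici _ from hy), Pi.one_apply, mul_one]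
    · have hmem : (x, r, y) ∉ S.successRegion τreq Vreq := fun h => hy h.2.2
      rw [indicator_of_notMem (show y ∉ Ici _ from hy)]
      simp [indicator_of_notMem hmem]
  · rw [indicator_of_notMem (by exact h)]
    have h0 : ∀ y, (S.successRegion τreq Vreq).indicator (1 : ℝ × ℝ × ℝ → ℝ≥0∞) (x, r, y) = 0 :=
      fun y => indicator_of_notMem (fun hy => h ⟨hy.1, hy.2.1⟩) _
    simp [h0]

/-- The success probability as a Lebesgue integral over the laws of the normalized gains and of
the squared correlation. -/
lemma measure_zfSuccess {Ω : Type*} [MeasurableSpace Ω] (P : Measure Ω) [IsProbabilityMeasure P]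
    {hD hU : Ω → S.Vec} (hD_law : HasLaw hD (complexNormalVec S.M S.betaD) P)
    (hU_law : HasLaw hU (complexNormalVec S.M S.betaU) P) (h_indep : IndepFun hD hU P)
    {τreq Vreq : ℝ} (hτ : 0 < τreq) (hV : S.noiseVar < Vreq) :
    P {ω | S.ZFSuccess τreq Vreq (hD ω) (hU ω)} =
      ∫⁻ x in Ioi (S.etaV Vreq), S.innerLIntegral τreq Vreq x := by
  have hM1 : 1 ≤ S.M := one_le_two.trans S.two_le_M
  have hR := S.measurableSet_successRegion τreq Vreq
  set R := S.successRegion τreq Vreq with hRdef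
  have hind : Measurable (R.indicator (1 : ℝ × ℝ × ℝ → ℝ≥0∞)) := measurable_one.indicator hR
  set T : S.Vec × S.Vec → ℝ × ℝ × ℝ := fun q => (‖q.1‖ ^ 2 / S.betaD,
    ‖inner ℂ q.2 q.1‖ ^ 2 / (‖q.2‖ ^ 2 * ‖q.1‖ ^ 2), ‖q.2‖ ^ 2 / S.betaU) with hT
  have hTmeas : Measurable T := by
    rw [hT]
    fun_prop
  have hjoint : P.map (fun ω => (hD ω, hU ω)) =
      (complexNormalVec S.M S.betaD).prod (complexNormalVec S.M S.betaU) := by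
    rw [(indepFun_iff_map_prod_eq_prod_map_map hD_law.aemeasurable hU_law.aemeasurable).mp h_indep,
      hD_law.map_eq, hU_law.map_eq]
  -- Off the null event `hD = 0 ∨ hU = 0`, success is read off from the three normalized quantities.
  have hae : {ω | S.ZFSuccess τreq Vreq (hD ω) (hU ω)} =ᵐ[P] {ω | T (hD ω, hU ω) ∈ R} := by
    have hD0 : ∀ᵐ ω ∂P, hD ω ≠ 0 := ae_of_ae_map hD_law.aemeasurable (p := fun h => h ≠ 0) (by
      rw [hD_law.map_eq]
      exact ae_ne_zero_complexNormalVec hM1 S.betaD_pos)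
    have hU0 : ∀ᵐ ω ∂P, hU ω ≠ 0 := ae_of_ae_map hU_law.aemeasurable (p := fun h => h ≠ 0) (by
      rw [hU_law.map_eq]
      exact ae_ne_zero_complexNormalVec hM1 S.betaU_pos)
    filter_upwards [hD0, hU0] with ω h1 h2
    exact propext (S.zfSuccess_iff hτ hV h1 h2)
  set ν : Measure (ℝ × ℝ) :=
    (volume.restrict (Ioi (0 : ℝ))).prod (volume.restrict (Ioo (0 : ℝ) 1)) with hν
  -- `K` is the joint density of gain and correlation times the indicator of success, kept opaque.
  obtain ⟨K, hK⟩ : ∃ K : ℝ × ℝ → ℝ → ℝ≥0∞, ∀ p y, K p y = ENNReal.ofReal (S.gainPDF p.1) *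
    (ENNReal.ofReal (S.corrPDF p.2) * R.indicator 1 (p.1, p.2, y)) := ⟨_, fun _ _ => rfl⟩
  have hKmeas : Measurable fun q : (ℝ × ℝ) × ℝ => K q.1 q.2 := by
    have : Measurable fun q : (ℝ × ℝ) × ℝ =>
        R.indicator (1 : ℝ × ℝ × ℝ → ℝ≥0∞) (q.1.1, q.1.2, q.2) := hind.comp (by fun_prop)
    simp_rw [hK]
    fun_prop
  have hK1 : ∀ y, Measurable fun p => K p y := fun y => hKmeas.comp measurable_prodMk_right
  have hΦ : Measurable fun y : ℝ => ∫⁻ p, K p y ∂ν :=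
    Measurable.lintegral_prod_left' (f := fun q : (ℝ × ℝ) × ℝ => K q.1 q.2) hKmeas
  calc P {ω | S.ZFSuccess τreq Vreq (hD ω) (hU ω)}
      = P.map (fun ω => (hD ω, hU ω)) (T ⁻¹' R) := by
        rw [measure_congr hae, Measure.map_apply_of_aemeasurable
          (hD_law.aemeasurable.prodMk hU_law.aemeasurable) (hTmeas hR)]
        rfl
    _ = ∫⁻ u, ∫⁻ h, R.indicator 1 (T (h, u)) ∂(complexNormalVec S.M S.betaD)
          ∂(complexNormalVec S.M S.betaU) := by
        rw [hjoint, ← lintegral_indicator_one (hTmeas hR)]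
        exact lintegral_prod_symm' _ (hind.comp hTmeas)
    _ = ∫⁻ u, ∫⁻ p, K p (‖u‖ ^ 2 / S.betaU) ∂ν ∂(complexNormalVec S.M S.betaU) := by
        -- The law of the gain and the correlation given `hU = u` does not depend on `u ≠ 0`.
        refine lintegral_congr_ae ?_
        filter_upwards [ae_ne_zero_complexNormalVec hM1 S.betaU_pos] with u hu
        have hg : Measurable (Function.uncurry fun x r : ℝ =>
            R.indicator (1 : ℝ × ℝ × ℝ → ℝ≥0∞) (x, r, ‖u‖ ^ 2 / S.betaU)) :=
          hind.comp (f := fun p : ℝ × ℝ => (p.1, p.2, ‖u‖ ^ 2 / S.betaU)) (by fun_prop)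
        have h := lintegral_gain_correlation S.two_le_M S.betaD_pos hu hg
        rw [hν, lintegral_prod _ (hK1 _).aemeasurable]
        simp_rw [hK]
        exact h
    _ = ∫⁻ y in Ioi (0 : ℝ), ENNReal.ofReal (S.gainPDF y) * ∫⁻ p, K p y ∂ν :=
        lintegral_norm_sq_complexNormalVec hM1 S.betaU_pos hΦ
    _ = ∫⁻ y in Ioi (0 : ℝ), ∫⁻ p, ENNReal.ofReal (S.gainPDF y) * K p y ∂ν := by
        refine lintegral_congr fun y => ?_
        rw [lintegral_const_mul _ (hK1 y)]
    _ = ∫⁻ p, ∫⁻ y in Ioi (0 : ℝ), ENNReal.ofReal (S.gainPDF y) * K p y ∂volume ∂ν := by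
        refine lintegral_lintegral_swap (Measurable.aemeasurable ?_)
        have : Measurable fun q : ℝ × ℝ × ℝ => K q.2 q.1 := hKmeas.comp measurable_swap
        change Measurable fun q : ℝ × ℝ × ℝ => ENNReal.ofReal (S.gainPDF q.1) * K q.2 q.1
        fun_prop
    _ = ∫⁻ x in Ioi (0 : ℝ), ∫⁻ r in Ioo (0 : ℝ) 1, ∫⁻ y in Ioi (0 : ℝ),
          ENNReal.ofReal (S.gainPDF y) * K (x, r) y := by
        rw [hν, lintegral_prod]
        refine (Measurable.lintegral_prod_right' (f := fun q : (ℝ × ℝ) × ℝ =>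
          ENNReal.ofReal (S.gainPDF q.2) * K q.1 q.2) ?_).aemeasurable
        fun_prop
    _ = ∫⁻ x in Ioi (0 : ℝ), (Ioi (S.etaV Vreq)).indicator (S.innerLIntegral τreq Vreq) x := by
        refine setLIntegral_congr_fun measurableSet_Ioi fun x hx => ?_
        have hx0 : (0 : ℝ) < x := hx
        have hsec : ∀ r, ∫⁻ y in Ioi (0 : ℝ), ENNReal.ofReal (S.gainPDF y) * K (x, r) y =
            ENNReal.ofReal (S.gainPDF x) * (ENNReal.ofReal (S.corrPDF r) *
              {p : ℝ × ℝ | S.etaV Vreq < p.1 ∧ 0 < (1 - p.2) * p.1 - S.etaF Vreq p.1}.indicator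
              (fun p => ENNReal.ofReal (1 - S.gainCDF (S.phi τreq Vreq p.1 p.2))) (x, r)) := by
          intro r
          have hi : Measurable fun y : ℝ => R.indicator (1 : ℝ × ℝ × ℝ → ℝ≥0∞) (x, r, y) :=
            hind.comp (by fun_prop)
          rw [← S.lintegral_successRegion_section hτ hx0, ← lintegral_const_mul _ (by fun_prop),
            ← lintegral_const_mul _ (by fun_prop)]
          refine lintegral_congr fun y => ?_
          simp only [hK]
          ring
        simp_rw [hsec]
        by_cases hxV : S.etaV Vreq < x
        · rw [indicator_of_mem (by exact hxV), innerLIntegral,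
            ← lintegral_indicator measurableSet_Ioo, ← lintegral_indicator measurableSet_Ioo]
          refine lintegral_congr fun r => ?_
          by_cases hr : r ∈ Ioo 0 (S.zfUpper Vreq x)
          · have hr1 : r < 1 := hr.2.trans (S.zfUpper_lt_one hV hxV)
            have hden := (S.lt_zfUpper_iff hx0 hr.1).mp hr.2
            rw [indicator_of_mem hr, indicator_of_mem (show r ∈ Ioo 0 1 from ⟨hr.1, hr1⟩),
              indicator_of_mem (by exact ⟨hxV, hden⟩), zfIntegrand,
              ENNReal.ofReal_mul (mul_nonneg (S.gainPDF_nonneg hx0.le) (S.corrPDF_nonneg hr1.le)),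
              ENNReal.ofReal_mul (S.gainPDF_nonneg hx0.le), mul_assoc]
          · rw [indicator_of_notMem hr]
            by_cases hr1 : r ∈ Ioo (0 : ℝ) 1
            · rw [indicator_of_mem hr1, indicator_of_notMem, mul_zero, mul_zero]
              exact fun h => hr ⟨hr1.1, (S.lt_zfUpper_iff hx0 hr1.1).mpr h.2⟩
            · rw [indicator_of_notMem hr1]
        · rw [indicator_of_notMem (by exact hxV)]
          have h0 : ∀ r, {p : ℝ × ℝ | S.etaV Vreq < p.1 ∧
              0 < (1 - p.2) * p.1 - S.etaF Vreq p.1}.indicator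
              (fun p => ENNReal.ofReal (1 - S.gainCDF (S.phi τreq Vreq p.1 p.2))) (x, r) = 0 :=
            fun r => indicator_of_notMem (fun h => hxV h.1) _
          simp_rw [h0, mul_zero, lintegral_zero]
    _ = _ := by
        rw [setLIntegral_indicator measurableSet_Ioi, inter_eq_left.mpr]
        exact Ioi_subset_Ioi (S.etaV_pos hV).le

end JDCCSystem

theorem theorem7 (S : JDCCSystem) {Ω : Type*} [MeasurableSpace Ω] (P : Measure Ω)
    [IsProbabilityMeasure P] (hD hU : Ω → EuclideanSpace ℂ (Fin S.M))
    (hD_law : HasLaw hD (complexNormalVec S.M S.betaD) P)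
    (hU_law : HasLaw hU (complexNormalVec S.M S.betaU) P)
    (h_indep : IndepFun hD hU P)
    (τreq Vreq : ℝ) (hτ : 0 < τreq) (hV : S.noiseVar < Vreq) :
    (∀ x ∈ Ioi (S.etaV Vreq),
      IntervalIntegrable (fun r => S.zfIntegrand τreq Vreq x r) volume 0 (S.zfUpper Vreq x)) ∧
    IntegrableOn
      (fun x => ∫ r in (0 : ℝ)..(S.zfUpper Vreq x), S.zfIntegrand τreq Vreq x r)
      (Ioi (S.etaV Vreq)) volume ∧
    S.zfOutage P hD hU τreq Vreq =
      1 - ∫ x in Ioi (S.etaV Vreq),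
            ∫ r in (0 : ℝ)..(S.zfUpper Vreq x), S.zfIntegrand τreq Vreq x r := by
  have hP := S.measure_zfSuccess P hD_law hU_law h_indep hτ hV
  have hfin : ∫⁻ x in Ioi (S.etaV Vreq), S.innerLIntegral τreq Vreq x ≠ ⊤ :=
    hP ▸ measure_ne_top P _
  have hmeas := S.measurable_innerLIntegral τreq Vreq
  have hinner : EqOn
      (fun x => ∫ r in (0 : ℝ)..(S.zfUpper Vreq x), S.zfIntegrand τreq Vreq x r)
      (fun x => (S.innerLIntegral τreq Vreq x).toReal) (Ioi (S.etaV Vreq)) :=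
    fun x hx => S.integral_zfIntegrand hτ hV hx
  refine ⟨fun x hx => ?_, ?_, ?_⟩
  · rw [intervalIntegrable_iff_integrableOn_Ioo_of_le (S.zfUpper_nonneg _ _)]
    exact S.integrableOn_zfIntegrand hτ hV hx
  · exact (integrableOn_congr_fun hinner measurableSet_Ioi).mpr
      (integrable_toReal_of_lintegral_ne_top hmeas.aemeasurable hfin)
  · rw [JDCCSystem.zfOutage, Measure.real, hP, setIntegral_congr_fun measurableSet_Ioi hinner,
      integral_toReal hmeas.aemeasurable (ae_lt_top hmeas hfin)]
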